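/- **Setting.** Let $V=\{v_i : i\in I\}\subset\mathbb R^N$ be a finite set of distinct points and let $\pi_j:[0,l_j]\to\mathbb R^N$ ($j\in J$, $J$ finite, $l_j>0$) be differentiable injective curves; put $e_j=\pi_j((0,l_j))$, $\bar e_j=\pi_j([0,l_j])$. Assume that $\pi_j(0),\pi_j(l_j)\in V$ and $\#(\bar e_j\cap V)=2$ for all $j$; that $\bar e_j\cap\bar e_k\subset V$ and $\#(\bar e_j\cap\bar e_k)\le 1$ for $j\ne k$; and that for all $v,w\in V$ there is a finite sequence of edges, the first closed edge containing $v$, the last containing $w$, any two consecutive closed edges having exactly one common point. Let $\bar\Gamma=\bigcup_j\bar e_j$, $Inc_i=\{j: v_i\in\bar e_j\}$, let $I_B\subset I$ be nonempty and contain every $i$ with $\#Inc_i=1$, and put $\partial\Gamma=\{v_i:i\in I_B\}$, $\Gamma=\bar\Gamma\setminus\partial\Gamma$. Let $f:\bar\Gamma\to\mathbb R$ be continuous with $f\ge\eta$ on $\Gamma$ for some constant $\eta>0$, and let $g:\partial\Gamma\to\mathbb R$. **Viscosity solutions.** For a function $\phi$ write $\partial_j\phi(x)=(\phi\circ\pi_j)'(\pi_j^{-1}(x))$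 (one-sided at end-points), and let $a_{ij}=1$ if $\pi_j(0)=v_i$, $a_{ij}=-1$ if $\pi_j(l_j)=v_i$, and $a_{ij}=0$ otherwise. For $i\notin I_B$ and $j\neq k$ in $Inc_i$, $\phi$ is called $(j,k)$-differentiable at $v_i$ if $\partial_j\phi(v_i)$, $\partial_k\phi(v_i)$ exist and $a_{ij}\partial_j\phi(v_i)+a_{ik}\partial_k\phi(v_i)=0$. Test functions $\phi$ are continuous on $\Gamma$. An upper semicontinuous $u:\bar\Gamma\to\mathbb R$ is a *subsolution* if (i) $|\partial_j\phi(x)|\le f(x)$ whenever $x\in e_j$, $\phi$ is differentiable at $x$ along $e_j$, and $u-\phi$ has a local maximum at $x$; and (ii) $|\partial_j\phi(v_i)|\le f(v_i)$ whenever $i\notin I_B$, $j\ne k$ are in $Inc_i$, $\phi$ is $(j,k)$-differentiable at $v_i$, and $u-\phi$ has a local maximum at $v_i$. A lower semicontinuous $u:\bar\Gamma\to\mathbb R$ is a *supersolution* if (i) $|\partial_j\phi(x)|\ge f(x)$ whenever $x\in e_j$, $\phi$ is differentiable at $x$ along $e_j$, and $u-\phi$ has a local minimum at $x$; and (ii)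 for all $i\notin I_B$ and $j\in Inc_i$ there is $k\in Inc_i$, $k\ne j$, such that $|\partial_j\phi(v_i)|\ge f(v_i)$ for every $\phi$ that is $(j,k)$-differentiable at $v_i$ and for which $u-\phi$ has a local minimum at $v_i$. A *viscosity solution* of $$|\partial u|=f \text{ in }\Gamma,\qquad u=g\text{ on }\partial\Gamma \tag{1}$$ is a continuous $u:\bar\Gamma\to\mathbb R$ that is both a subsolution and a supersolution and equals $g$ on $\partial\Gamma$. **Distance.** For $x,y\in\bar\Gamma$ let $S(x,y)=\inf\int_0^t f(\gamma(s))\,ds$ over all $t>0$ and all continuous paths $\gamma:[0,t]\to\bar\Gamma$ from $x$ to $y$ for which there is a finite partition of $[0,t]$ such that, on each of its closed intervals, $\gamma$ stays in one closed edge $\bar e_j$ and, on the corresponding open interval, $\pi_j^{-1}\circ\gamma$ is $C^1$ with $|(\pi_j^{-1}\circ\gamma)'|=1$. **Scheme.** Let $h>0$. A discrete trajectory from $x$ to $y$ consists of points $\gamma_0=x,\gamma_1,\dots,\gamma_M=y$ of $\bar\Gamma$ ($M\ge0$) and edges $j_0,\dots,j_{M-1}$ such that $\gamma_m,\gamma_{m+1}\in\bar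 e_{j_m}$ and $|q_m|\le1$, where $q_m=\big(\pi_{j_m}^{-1}(\gamma_{m+1})-\pi_{j_m}^{-1}(\gamma_m)\big)/h$; its cost is $\mathcal F_h(\gamma)=\sum_{m=0}^{M-1}h f(\gamma_m)|q_m|$. Define $u_h:\bar\Gamma\to\mathbb R$ by $$u_h(x)=\inf\{\mathcal F_h(\gamma)+g(y):\ y\in\partial\Gamma,\ \gamma\text{ a discrete trajectory from }x\text{ to }y\}.$$ For bounded $\phi:\bar\Gamma\to\mathbb R$ put $S(h,x,\phi)=g(x)$ if $x\in\partial\Gamma$ and, if $x\in\Gamma$, $$S(h,x,\phi)=\inf\{\phi(\pi_k(\pi_k^{-1}(x)-hq))+hf(x)|q|\},$$ the infimum being over all $k\in J$ with $x\in\bar e_k$ and all $q\in[-1,1]$ with $\pi_k^{-1}(x)-hq\in[0,l_k]$. **Theorem.** Assume that $g(x)\le u_h(x)$ for all $x\in\partial\Gamma$ and all $h>0$ (discrete compatibility), and that $g(x)-g(y)\le S(y,x)$ for all $x,y\in\partial\Gamma$ (continuous compatibility). Then, for every $h>0$, $u_h$ is a bounded solution of $u_h(x)=S(h,x,u_h)$,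 $x\in\bar\Gamma$, and it is the greatest one: every bounded solution $w$ satisfies $w\le u_h$ on $\bar\Gamma$. Moreover the problem (1) has exactly one viscosity solution $u$, and $u_h\to u$ uniformly on $\bar\Gamma$ as $h\to0^+$. -/

import Mathlib

open Set Filter Topology

noncomputable section

/-- A finite topological network in `ℝⁿ`: finitely many distinct vertices `v i` and finitely many
differentiable, non self-intersecting arcs `π j : [0, l j] → ℝⁿ` (values of `π j` outside
`[0, l j]` are never used). -/
structure Network (n : ℕ) (I J : Type*) where
  v : I → EuclideanSpace ℝ (Fin n)
  v_injective : Function.Injective v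
  l : J → ℝ
  l_pos : ∀ j, 0 < l j
  π : J → ℝ → EuclideanSpace ℝ (Fin n)
  π_differentiable : ∀ j, DifferentiableOn ℝ (π j) (Icc 0 (l j))
  π_injOn : ∀ j, InjOn (π j) (Icc 0 (l j))
  π_zero_mem : ∀ j, π j 0 ∈ range v
  π_length_mem : ∀ j, π j (l j) ∈ range v
  encard_vertices : ∀ j, (π j '' Icc 0 (l j) ∩ range v).encard = 2
  inter_subset : ∀ j k, j ≠ k → π j '' Icc 0 (l j) ∩ π k '' Icc 0 (l k) ⊆ range v
  encard_inter : ∀ j k, j ≠ k → (π j '' Icc 0 (l j) ∩ π k '' Icc 0 (l k)).encard ≤ 1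
  connected : ∀ i i', ∃ (m : ℕ) (p : Fin (m + 1) → J),
    v i ∈ π (p 0) '' Icc 0 (l (p 0)) ∧
    v i' ∈ π (p (Fin.last m)) '' Icc 0 (l (p (Fin.last m))) ∧
    ∀ r : Fin m, (π (p r.castSucc) '' Icc 0 (l (p r.castSucc)) ∩
      π (p r.succ) '' Icc 0 (l (p r.succ))).encard = 1

namespace Network

variable {n : ℕ} {I J : Type*} (G : Network n I J)

/-- The open edge `e_j`. -/
def edge (j : J) : Set (EuclideanSpace ℝ (Fin n)) := G.π j '' Ioo 0 (G.l j)

/-- The closed edge `ē_j`. -/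
def closedEdge (j : J) : Set (EuclideanSpace ℝ (Fin n)) := G.π j '' Icc 0 (G.l j)

/-- The network `Γ̄`, the union of the closed edges. -/
def carrier : Set (EuclideanSpace ℝ (Fin n)) := ⋃ j, G.closedEdge j

/-- The indices of the edges incident to the vertex `v i`. -/
def Inc (i : I) : Set J := {j | G.v i ∈ G.closedEdge j}

/-- The boundary `∂Γ` determined by the set `B` of indices of boundary vertices. -/
def boundary (B : Set I) : Set (EuclideanSpace ℝ (Fin n)) := G.v '' B

/-- `Γ = Γ̄ \ ∂Γ`. -/
def interior (B : Set I) : Set (EuclideanSpace ℝ (Fin n)) := G.carrier \ G.boundary B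

/-- The inverse parametrization `π_j⁻¹ : ē_j → [0, l_j]`. -/
def coord (j : J) (x : EuclideanSpace ℝ (Fin n)) : ℝ :=
  Function.invFunOn (G.π j) (Icc 0 (G.l j)) x

/-- The signed incidence coefficient `a_{ij}`. -/
def sign (i : I) (j : J) : ℝ :=
  open Classical in
  if G.π j 0 = G.v i then 1 else if G.π j (G.l j) = G.v i then -1 else 0

/-- `φ^j = φ ∘ π_j : [0, l_j] → ℝ` is differentiable at `π_j⁻¹(x)`
(one-sided if `x` is an end-point of the edge). -/
def DiffAlong (φ : EuclideanSpace ℝ (Fin n) → ℝ) (j : J) (x : EuclideanSpace ℝ (Fin n)) : Prop :=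
  DifferentiableWithinAt ℝ (φ ∘ G.π j) (Icc 0 (G.l j)) (G.coord j x)

/-- The derivative `∂_j φ(x)` along the edge `j` (one-sided if `x` is an end-point). -/
def edgeDeriv (φ : EuclideanSpace ℝ (Fin n) → ℝ) (j : J) (x : EuclideanSpace ℝ (Fin n)) : ℝ :=
  derivWithin (φ ∘ G.π j) (Icc 0 (G.l j)) (G.coord j x)

/-- `φ` is `(j,k)`-differentiable at the vertex `v i`. -/
def PairDiff (φ : EuclideanSpace ℝ (Fin n) → ℝ) (i : I) (j k : J) : Prop :=
  G.DiffAlong φ j (G.v i) ∧ G.DiffAlong φ k (G.v i) ∧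
    G.sign i j * G.edgeDeriv φ j (G.v i) + G.sign i k * G.edgeDeriv φ k (G.v i) = 0

/-- Viscosity subsolutions of `|∂u| - f = 0` in `Γ`. -/
def IsSubsolution (B : Set I) (f u : EuclideanSpace ℝ (Fin n) → ℝ) : Prop :=
  UpperSemicontinuousOn u G.carrier ∧
  (∀ j, ∀ x ∈ G.edge j, ∀ φ : EuclideanSpace ℝ (Fin n) → ℝ,
    ContinuousOn φ (G.interior B) → G.DiffAlong φ j x →
    IsLocalMaxOn (fun y => u y - φ y) (G.interior B) x →
    |G.edgeDeriv φ j x| - f x ≤ 0) ∧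
  (∀ i, i ∉ B → ∀ j ∈ G.Inc i, ∀ k ∈ G.Inc i, j ≠ k → ∀ φ : EuclideanSpace ℝ (Fin n) → ℝ,
    ContinuousOn φ (G.interior B) → G.PairDiff φ i j k →
    IsLocalMaxOn (fun y => u y - φ y) (G.interior B) (G.v i) →
    |G.edgeDeriv φ j (G.v i)| - f (G.v i) ≤ 0)

/-- Viscosity supersolutions of `|∂u| - f = 0` in `Γ`: at a transition vertex, for each incident
edge `j` there has to be a feasible incident edge `k ≠ j`. -/
def IsSupersolution (B : Set I) (f u : EuclideanSpace ℝ (Fin n) → ℝ) : Prop :=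
  LowerSemicontinuousOn u G.carrier ∧
  (∀ j, ∀ x ∈ G.edge j, ∀ φ : EuclideanSpace ℝ (Fin n) → ℝ,
    ContinuousOn φ (G.interior B) → G.DiffAlong φ j x →
    IsLocalMinOn (fun y => u y - φ y) (G.interior B) x →
    0 ≤ |G.edgeDeriv φ j x| - f x) ∧
  (∀ i, i ∉ B → ∀ j ∈ G.Inc i, ∃ k ∈ G.Inc i, k ≠ j ∧ ∀ φ : EuclideanSpace ℝ (Fin n) → ℝ,
    ContinuousOn φ (G.interior B) → G.PairDiff φ i j k →
    IsLocalMinOn (fun y => u y - φ y) (G.interior B) (G.v i) →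
    0 ≤ |G.edgeDeriv φ j (G.v i)| - f (G.v i))

/-- Viscosity solutions of the Dirichlet problem `|∂u| = f` in `Γ`, `u = g` on `∂Γ`. -/
def IsDirichletSolution (B : Set I) (f g u : EuclideanSpace ℝ (Fin n) → ℝ) : Prop :=
  ContinuousOn u G.carrier ∧ G.IsSubsolution B f u ∧ G.IsSupersolution B f u ∧
    ∀ x ∈ G.boundary B, u x = g x

/-- `γ ∈ B^t_{x,y}`: a piecewise differentiable unit speed path `γ : [0,t] → Γ̄` from `x` to `y`. -/
def IsPath (t : ℝ) (x y : EuclideanSpace ℝ (Fin n)) (γ : ℝ → EuclideanSpace ℝ (Fin n)) : Prop :=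
  ContinuousOn γ (Icc 0 t) ∧ γ 0 = x ∧ γ t = y ∧
  ∃ (r : ℕ) (τ : Fin (r + 2) → ℝ), StrictMono τ ∧ τ 0 = 0 ∧ τ (Fin.last (r + 1)) = t ∧
    ∀ m : Fin (r + 1), ∃ j,
      MapsTo γ (Icc (τ m.castSucc) (τ m.succ)) (G.closedEdge j) ∧
      ContDiffOn ℝ 1 (G.coord j ∘ γ) (Ioo (τ m.castSucc) (τ m.succ)) ∧
      ∀ s ∈ Ioo (τ m.castSucc) (τ m.succ), |deriv (G.coord j ∘ γ) s| = 1

/-- The distance-like function `S(x,y)`. -/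
def optDist (f : EuclideanSpace ℝ (Fin n) → ℝ) (x y : EuclideanSpace ℝ (Fin n)) : ℝ :=
  sInf {c | ∃ t > 0, ∃ γ, G.IsPath t x y γ ∧ c = ∫ s in (0 : ℝ)..t, f (γ s)}

/-- The velocity `q_m` of the step from `γ m` to `γ (m + 1)` inside the edge `j m`. -/
def velocity (h : ℝ) (γ : ℕ → EuclideanSpace ℝ (Fin n)) (j : ℕ → J) (m : ℕ) : ℝ :=
  (G.coord (j m) (γ (m + 1)) - G.coord (j m) (γ m)) / h

/-- `(γ_0, …, γ_M)`, with edges `j_0, …, j_{M-1}`, is an admissible discrete trajectory from `x`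
to `y`, i.e. an element of `B^h_{x,y}`. -/
def IsTrajectory (h : ℝ) (x y : EuclideanSpace ℝ (Fin n)) (M : ℕ)
    (γ : ℕ → EuclideanSpace ℝ (Fin n)) (j : ℕ → J) : Prop :=
  γ 0 = x ∧ γ M = y ∧ ∀ m < M, γ m ∈ G.closedEdge (j m) ∧ γ (m + 1) ∈ G.closedEdge (j m) ∧
    |G.velocity h γ j m| ≤ 1

/-- The discrete cost `F_h(γ) = ∑ h f(γ_m) |q_m|`. -/
def discreteCost (f : EuclideanSpace ℝ (Fin n) → ℝ) (h : ℝ) (M : ℕ)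
    (γ : ℕ → EuclideanSpace ℝ (Fin n)) (j : ℕ → J) : ℝ :=
  ∑ m ∈ Finset.range M, h * f (γ m) * |G.velocity h γ j m|

/-- `inf {F_h(γ) + g(y) : γ ∈ B^h_{x,y}, y ∈ ∂Γ}`; as a function of `x` this is `u_h`. -/
def discreteValue (B : Set I) (f g : EuclideanSpace ℝ (Fin n) → ℝ) (h : ℝ)
    (x : EuclideanSpace ℝ (Fin n)) : ℝ :=
  sInf {c | ∃ y ∈ G.boundary B, ∃ M γ j, G.IsTrajectory h x y M γ j ∧
    c = G.discreteCost f h M γ j + g y}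

/-- The semi-Lagrangian operator `S(h, x, φ)`. The infimum is over all closed edges `k` containing
`x` (only one if `x` is not a vertex) and all `q ∈ [-1,1]` with `x_{hq} = π_k(π_k⁻¹(x) - hq)` in
`ē_k`. -/
def scheme (B : Set I) (f g : EuclideanSpace ℝ (Fin n) → ℝ) (h : ℝ)
    (φ : EuclideanSpace ℝ (Fin n) → ℝ) (x : EuclideanSpace ℝ (Fin n)) : ℝ :=
  open Classical in
  if x ∈ G.boundary B then g x
  else sInf {c | ∃ k, x ∈ G.closedEdge k ∧ ∃ q ∈ Icc (-1 : ℝ) 1,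
    G.coord k x - h * q ∈ Icc 0 (G.l k) ∧
    c = φ (G.π k (G.coord k x - h * q)) + h * f x * |q|}

/-- `u` is a bounded solution of `u(x) = S(h, x, u)` on `Γ̄`. -/
def IsSchemeSolution (B : Set I) (f g : EuclideanSpace ℝ (Fin n) → ℝ) (h : ℝ)
    (u : EuclideanSpace ℝ (Fin n) → ℝ) : Prop :=
  (∃ C, ∀ x ∈ G.carrier, |u x| ≤ C) ∧ ∀ x ∈ G.carrier, u x = G.scheme B f g h u x

end Network

end

/-! ### One-dimensional viscosity estimates. -/

noncomputable section

/-! On an edge, let `A` be a primitive of `f`. There `|∂u| = f` says that `u` at a point is the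
least of the two end-point values, each increased by the difference of `A`. The candidate solution
is therefore `contValue`: the least total cost of a chain of edge moves ending on `∂Γ`, plus `g` at
the end.

For continuous functions, being a subsolution amounts to growing along edges no faster than `A`
(`EdgeLipschitz`). Adding this along chains gives `w ≤ u` for every solution `w`. A supersolution
descends from each point of `Γ` by the full cost of some edge move: if this failed at a transition
vertex, the vertex would be a local minimum, which the zero test function forbids because `f > 0`.
Costs are positive and vertices finite in number, so `w ≥ u` follows
(`IsSupersolution.ge_of_edgeStep`).

The discrete function `u_h` is the value of the same kind of problem with short steps, so the scheme
is its dynamic programming equation. Uniform continuity of `f` and `f ≥ η` make discrete and exact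
costs agree up to factors `1 ± κ` for small `h` (`eventually_step_cost`). Hence `|u_h - u| ≤ κ (u +
m)`, where `-m` bounds `g` below. On `∂Γ`, `u ≤ g` by the empty chain, and `g ≤ u` is the limit of
`g ≤ u_h`. -/

lemma deriv_nonneg_of_eventually_right {ψ : ℝ → ℝ} {d a b s : ℝ}
    (h : HasDerivWithinAt ψ d (Icc a b) s) (ha : a ≤ s) (hs : s < b)
    (hev : ∀ᶠ t in 𝓝[>] s, ψ s ≤ ψ t) : 0 ≤ d := by
  have h1 : HasDerivWithinAt ψ d (Ioi s) s :=
    h.mono_of_mem_nhdsWithin (mem_of_superset (Ioc_mem_nhdsGT hs)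
      fun t ht => ⟨ha.trans ht.1.le, ht.2⟩)
  rw [hasDerivWithinAt_iff_tendsto_slope' (by simp)] at h1
  refine ge_of_tendsto h1 ?_
  filter_upwards [hev, self_mem_nhdsWithin] with t ht hst
  rw [slope_def_field]
  exact div_nonneg (sub_nonneg.2 ht) (sub_nonneg.2 (le_of_lt hst))

lemma deriv_nonpos_of_eventually_left {ψ : ℝ → ℝ} {d a b s : ℝ}
    (h : HasDerivWithinAt ψ d (Icc a b) s) (ha : a < s) (hs : s ≤ b)
    (hev : ∀ᶠ t in 𝓝[<] s, ψ s ≤ ψ t) : d ≤ 0 := by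
  have h1 : HasDerivWithinAt ψ d (Iio s) s :=
    h.mono_of_mem_nhdsWithin (mem_of_superset (Ico_mem_nhdsLT ha)
      fun t ht => ⟨ht.1, ht.2.le.trans hs⟩)
  rw [hasDerivWithinAt_iff_tendsto_slope' (by simp)] at h1
  refine le_of_tendsto h1 ?_
  filter_upwards [hev, self_mem_nhdsWithin] with t ht hst
  rw [slope_def_field]
  exact div_nonpos_of_nonneg_of_nonpos (sub_nonneg.2 ht) (sub_nonpos.2 (le_of_lt hst))

/-- One-sided growth bound for functions whose upper tests `ψ` satisfy `ψ' ≤ F`. -/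
lemma sub_le_sub_of_upper_tests {W A F : ℝ → ℝ} {p q : ℝ} (hW : ContinuousOn W (Icc p q))
    (hA : ∀ s, HasDerivAt A (F s) s)
    (hsub : ∀ s ∈ Ioo p q, ∀ (ψ : ℝ → ℝ) (d : ℝ), Continuous ψ → HasDerivAt ψ d s →
      IsLocalMax (fun r => W r - ψ r) s → d ≤ F s)
    {a b : ℝ} (ha : p ≤ a) (hab : a ≤ b) (hb : b ≤ q) : W b - W a ≤ A b - A a := by
  rcases hab.eq_or_lt with rfl | hab
  · simp
  by_contra! hlt
  have hAc : Continuous A := continuous_iff_continuousAt.2 fun s => (hA s).continuousAt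
  have hWab : ContinuousOn W (Icc a b) := hW.mono (Icc_subset_Icc ha hb)
  obtain ⟨m, hm, hmI⟩ : ∃ m, 0 < (W m - A m) - (W a - A a) ∧ m ∈ Ioo a b := by
    have hc : ContinuousWithinAt (fun r => (W r - A r) - (W a - A a)) (Ioo a b) b :=
      ((hWab.sub hAc.continuousOn).sub continuousOn_const b ⟨hab.le, le_rfl⟩).mono Ioo_subset_Icc_self
    have hev := hc.eventually (lt_mem_nhds (show (0 : ℝ) < _ by linarith))
    have : (𝓝[Ioo a b] b).NeBot := right_nhdsWithin_Ioo_neBot hab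
    exact (hev.and self_mem_nhdsWithin).exists
  obtain ⟨hma, hmb⟩ := hmI
  set gap := (W m - A m) - (W a - A a) with hgap
  set D := |(W b - A b) - (W m - A m)| + gap with hD
  have hDpos : 0 < D := by positivity
  obtain ⟨N, hN⟩ := exists_pow_lt_of_lt_one (show 0 < gap / (2 * D) by positivity)
    (show (m - a) / (b - a) < 1 by rw [div_lt_one (by linarith)]; linarith)
  set ε := gap / (4 * (b - a)) with hε
  have hba : 0 < b - a := by linarith
  have hεpos : 0 < ε := by positivity
  -- Its slope exceeds `F`, so an interior maximum of `W - ψ` is impossible. The linear term costs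
  -- at most `gap / 4` at `m`. The power term is below `gap / 2` at `m` but equals `D` at `b`, which
  -- keeps the maximum away from both end-points.
  set ψ : ℝ → ℝ := fun r => A r + ε * (r - a) + D * ((r - a) / (b - a)) ^ N with hψ
  have hψc : Continuous ψ := by fun_prop
  have hψd : ∀ r, HasDerivAt ψ
      (F r + ε * 1 + D * (N * ((r - a) / (b - a)) ^ (N - 1) * (1 / (b - a)))) r := by
    intro r
    have h1 : HasDerivAt (fun r : ℝ => r - a) 1 r := (hasDerivAt_id r).sub_const a
    exact ((hA r).add (h1.const_mul ε)).add (((h1.div_const _).pow N).const_mul D)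
  obtain ⟨r, hr, hmax⟩ := isCompact_Icc.exists_isMaxOn (nonempty_Icc.2 hab.le)
    (hWab.sub hψc.continuousOn)
  have hm' : W m - ψ m ≤ W r - ψ r := hmax ⟨hma.le, hmb.le⟩
  have hεm : ε * (m - a) ≤ gap / 4 := by
    rw [hε, div_mul_eq_mul_div, div_le_div_iff₀ (by positivity) (by norm_num)]
    nlinarith
  have hDm : D * ((m - a) / (b - a)) ^ N < gap / 2 := by
    have := mul_lt_mul_of_pos_left hN hDpos
    rwa [show D * (gap / (2 * D)) = gap / 2 by field_simp] at this
  have hra : r ≠ a := by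
    rintro rfl
    have h0 : 0 ≤ D * ((r - r) / (b - r)) ^ N := by
      rw [sub_self, zero_div]; positivity
    simp only [hψ] at hm'
    nlinarith
  have hrb : r ≠ b := by
    rintro rfl
    simp only [hψ, div_self hba.ne', one_pow] at hm'
    have := le_abs_self ((W r - A r) - (W m - A m))
    have := mul_pos hεpos hba
    nlinarith
  have hrI : r ∈ Ioo a b := ⟨lt_of_le_of_ne hr.1 hra.symm, lt_of_le_of_ne hr.2 hrb⟩
  have hloc : IsLocalMax (fun r => W r - ψ r) r :=
    hmax.isLocalMax (Icc_mem_nhds hrI.1 hrI.2)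
  have := hsub r ⟨ha.trans_lt hrI.1, hrI.2.trans_le hb⟩ ψ _ hψc (hψd r) hloc
  have : 0 ≤ D * (N * ((r - a) / (b - a)) ^ (N - 1) * (1 / (b - a))) := by
    have : 0 < r - a := sub_pos.2 hrI.1
    positivity
  linarith

/-- A viscosity subsolution of `|W'| = F` on an interval is dominated by the primitive of `F`. -/
lemma abs_sub_le_of_upper_tests {W A F : ℝ → ℝ} {l : ℝ} (hW : ContinuousOn W (Icc 0 l))
    (hA : ∀ s, HasDerivAt A (F s) s)
    (hsub : ∀ s ∈ Ioo 0 l, ∀ (ψ : ℝ → ℝ) (d : ℝ), Continuous ψ → HasDerivAt ψ d s →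
      IsLocalMax (fun r => W r - ψ r) s → |d| ≤ F s)
    {a b : ℝ} (ha : a ∈ Icc 0 l) (hb : b ∈ Icc 0 l) : |W a - W b| ≤ |A a - A b| := by
  have fwd : ∀ a b, 0 ≤ a → a ≤ b → b ≤ l → W b - W a ≤ A b - A a := fun a b h1 h2 h3 =>
    sub_le_sub_of_upper_tests hW hA
      (fun s hs ψ d h1 h2 h3 => (le_abs_self d).trans (hsub s hs ψ d h1 h2 h3)) h1 h2 h3
  have bwd : ∀ a b, 0 ≤ a → a ≤ b → b ≤ l → W a - W b ≤ A b - A a := by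
    intro a b h1 h2 h3
    -- Reflection `r ↦ -r` reduces this to the forward bound; `-A (-r)` is a primitive of `F (-r)`.
    have := sub_le_sub_of_upper_tests (W := fun r => W (-r)) (A := fun r => -A (-r))
      (F := fun r => F (-r)) (p := -l) (q := -0) (a := -b) (b := -a)
      (hW.comp continuous_neg.continuousOn fun r hr => ⟨by linarith [hr.2], by linarith [hr.1]⟩)
      (fun s => by
        exact ((hA (-s)).scomp s (hasDerivAt_neg s)).neg.congr_deriv (by simp))
      (fun s hs ψ d hc hd hloc => by
        have hs' : -s ∈ Ioo 0 l := ⟨by linarith [hs.2], by linarith [hs.1]⟩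
        have hd' : HasDerivAt (fun r => ψ (-r)) (-d) (-s) := by
          have hd2 : HasDerivAt ψ d (- -s) := by simpa using hd
          have := hd2.scomp (-s) (hasDerivAt_neg (-s))
          simpa [Function.comp_def] using this
        have hl' : IsLocalMax (fun r => W r - ψ (-r)) (-s) := by
          have ht : Tendsto (fun r : ℝ => -r) (𝓝 (-s)) (𝓝 s) := by
            simpa using (continuous_neg.tendsto (-s))
          have := ht.eventually hloc
          simpa [IsLocalMax, IsMaxFilter] using this
        have := hsub (-s) hs' _ _ (hc.comp continuous_neg) hd' hl'
        rw [abs_neg] at this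
        exact (le_abs_self d).trans this)
      (by linarith) (by linarith) (by linarith)
    simp only [neg_neg] at this
    linarith
  rcases le_total a b with h | h
  · have h1 := fwd a b ha.1 h hb.2
    have h2 := bwd a b ha.1 h hb.2
    rw [abs_sub_comm (A a)]
    exact (abs_le.2 ⟨by linarith, by linarith⟩).trans (le_abs_self _)
  · have h1 := fwd b a hb.1 h ha.2
    have h2 := bwd b a hb.1 h ha.2
    exact (abs_le.2 ⟨by linarith, by linarith⟩).trans (le_abs_self _)

/-- A viscosity supersolution of `|W'| = F` on an interval dominates the value function of its
end-point values. -/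
lemma le_of_lower_tests {W A F : ℝ → ℝ} {l : ℝ} (hW : ContinuousOn W (Icc 0 l))
    (hA : ∀ s, HasDerivAt A (F s) s) (hF : ∀ s, 0 < F s)
    (hsup : ∀ s ∈ Ioo 0 l, ∀ (ψ : ℝ → ℝ) (d : ℝ), Continuous ψ → HasDerivAt ψ d s →
      IsLocalMin (fun r => W r - ψ r) s → F s ≤ |d|)
    {s : ℝ} (hs : s ∈ Ioo 0 l) : W 0 + |A s - A 0| ≤ W s ∨ W l + |A s - A l| ≤ W s := by
  by_contra! hlt
  obtain ⟨h0, h1⟩ := hlt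
  have hAc : Continuous A := continuous_iff_continuousAt.2 fun s => (hA s).continuousAt
  set m := min (W 0 + |A s - A 0| - W s) (W l + |A s - A l| - W s) with hm
  have hmpos : 0 < m := lt_min (by linarith) (by linarith)
  set ε := m / 2 with hε
  have hεpos : 0 < ε := by positivity
  -- A smoothing of the inverted cone `-|A r - A s|`, whose slope is strictly below `F` in modulus
  -- everywhere. At `s` it is off by only `ε = m / 2`, less than the margin `m` at the end-points,
  -- so the minimum is interior.
  set Q : ℝ → ℝ := fun r => (A r - A s) ^ 2 + ε ^ 2 with hQ
  have hQpos : ∀ r, 0 < Q r := fun r => by positivity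
  have hψc : Continuous (fun r => -√(Q r)) := by fun_prop
  have hψd : ∀ r, HasDerivAt (fun r => -√(Q r)) (-((A r - A s) * F r / √(Q r))) r := by
    intro r
    have hq : HasDerivAt Q (2 * (A r - A s) * F r) r :=
      ((((hA r).sub_const (A s)).pow 2).add_const (ε ^ 2)).congr_deriv (by simp)
    exact (hq.sqrt (hQpos r).ne').neg.congr_deriv
      (by rw [mul_assoc, mul_div_mul_left _ _ two_ne_zero])
  have hlow : ∀ r, |A s - A r| ≤ √(Q r) := fun r => by
    rw [abs_sub_comm, ← Real.sqrt_sq_eq_abs]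
    exact Real.sqrt_le_sqrt (by simp only [hQ]; nlinarith)
  have hQs : √(Q s) = ε := by simp [hQ, Real.sqrt_sq hεpos.le]
  obtain ⟨r, hr, hmin⟩ := isCompact_Icc.exists_isMinOn (nonempty_Icc.2 (hs.1.trans hs.2).le)
    (hW.sub hψc.continuousOn)
  have hrs : W r - -√(Q r) ≤ W s - -√(Q s) := hmin ⟨hs.1.le, hs.2.le⟩
  rw [hQs] at hrs
  have hr0 : r ≠ 0 := by
    rintro rfl
    have := hlow 0
    have := min_le_left (W 0 + |A s - A 0| - W s) (W l + |A s - A l| - W s)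
    linarith
  have hrl : r ≠ l := by
    rintro rfl
    have := hlow r
    have := min_le_right (W 0 + |A s - A 0| - W s) (W r + |A s - A r| - W s)
    linarith
  have hrI : r ∈ Ioo 0 l := ⟨lt_of_le_of_ne hr.1 hr0.symm, lt_of_le_of_ne hr.2 hrl⟩
  have := hsup r hrI _ _ hψc (hψd r) (hmin.isLocalMin (Icc_mem_nhds hrI.1 hrI.2))
  have hlt : |A r - A s| < √(Q r) := by
    rw [← Real.sqrt_sq_eq_abs]
    exact Real.sqrt_lt_sqrt (sq_nonneg _) (by simp only [hQ]; nlinarith [sq_pos_of_pos hεpos])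
  have hsq := Real.sqrt_pos.2 (hQpos r)
  rw [abs_neg, abs_div, abs_mul, abs_of_pos (hF r), abs_of_pos hsq, le_div_iff₀ hsq] at this
  nlinarith [hF r]

/-- The primitive of a function bounded below by `η` increases with slope in the range of the
function. -/
lemma exists_abs_sub_eq_mul {A F : ℝ → ℝ} (hA : ∀ s, HasDerivAt A (F s) s) (hF : ∀ s, 0 < F s)
    (a b : ℝ) : ∃ r ∈ uIcc a b, |A a - A b| = F r * |a - b| := by
  wlog hab : a ≤ b generalizing a b
  · obtain ⟨r, hr, h⟩ := this b a (le_of_not_ge hab)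
    exact ⟨r, by rwa [uIcc_comm], by rw [abs_sub_comm, h, abs_sub_comm]⟩
  rcases hab.eq_or_lt with rfl | hab
  · exact ⟨a, by simp, by simp⟩
  · obtain ⟨r, hr, h⟩ := exists_hasDerivAt_eq_slope A F hab
      (fun s _ => (hA s).continuousAt.continuousWithinAt) fun s _ => hA s
    refine ⟨r, Icc_subset_uIcc (Ioo_subset_Icc_self hr), ?_⟩
    rw [eq_div_iff (by linarith)] at h
    rw [abs_sub_comm, ← h, abs_mul, abs_of_pos (hF r), abs_sub_comm a b]

/-! ### Geometry of the network and transfer of test functions. -/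

namespace Network

variable {n : ℕ} {I J : Type*} (G : Network n I J)

lemma continuousOn_π (j : J) : ContinuousOn (G.π j) (Icc 0 (G.l j)) :=
  (G.π_differentiable j).continuousOn

variable {G}

lemma π_mem_closedEdge {j : J} {s : ℝ} (hs : s ∈ Icc 0 (G.l j)) : G.π j s ∈ G.closedEdge j :=
  mem_image_of_mem _ hs

lemma closedEdge_subset_carrier (j : J) : G.closedEdge j ⊆ G.carrier :=
  subset_iUnion G.closedEdge j

lemma π_mem_carrier {j : J} {s : ℝ} (hs : s ∈ Icc 0 (G.l j)) : G.π j s ∈ G.carrier :=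
  closedEdge_subset_carrier j (π_mem_closedEdge hs)

lemma coord_π {j : J} {s : ℝ} (hs : s ∈ Icc 0 (G.l j)) : G.coord j (G.π j s) = s :=
  (G.π_injOn j).leftInvOn_invFunOn hs

lemma coord_mem {j : J} {x : EuclideanSpace ℝ (Fin n)} (hx : x ∈ G.closedEdge j) :
    G.coord j x ∈ Icc 0 (G.l j) :=
  Function.invFunOn_mem hx

lemma π_coord {j : J} {x : EuclideanSpace ℝ (Fin n)} (hx : x ∈ G.closedEdge j) :
    G.π j (G.coord j x) = x :=
  Function.invFunOn_eq hx

variable (G)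

lemma zero_mem_Icc (j : J) : (0 : ℝ) ∈ Icc 0 (G.l j) := left_mem_Icc.2 (G.l_pos j).le

lemma length_mem_Icc (j : J) : G.l j ∈ Icc 0 (G.l j) := right_mem_Icc.2 (G.l_pos j).le

lemma isCompact_closedEdge (j : J) : IsCompact (G.closedEdge j) :=
  isCompact_Icc.image_of_continuousOn (G.continuousOn_π j)

lemma isCompact_carrier [Finite J] : IsCompact G.carrier :=
  isCompact_iUnion G.isCompact_closedEdge

/-- A continuous injection of a compact interval has a continuous inverse: it sends closed subsets
to compact, hence closed, sets. -/
lemma continuousOn_coord (j : J) : ContinuousOn (G.coord j) (G.closedEdge j) := by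
  rw [continuousOn_iff_isClosed]
  intro t ht
  refine ⟨G.π j '' (Icc 0 (G.l j) ∩ t), ((isCompact_Icc.inter_right ht).image_of_continuousOn
    ((G.continuousOn_π j).mono inter_subset_left)).isClosed, ?_⟩
  ext x
  constructor
  · rintro ⟨hxt, hx⟩
    exact ⟨⟨_, ⟨coord_mem hx, hxt⟩, π_coord hx⟩, hx⟩
  · rintro ⟨⟨s, ⟨hs, hst⟩, rfl⟩, hx⟩
    exact ⟨by rwa [mem_preimage, coord_π hs], hx⟩

variable {G}

/-- The two end-points already use up the two vertices allowed on a closed edge. -/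
lemma eq_endpoint {j : J} {s : ℝ} (hs : s ∈ Icc 0 (G.l j)) (hv : G.π j s ∈ range G.v) :
    s = 0 ∨ s = G.l j := by
  by_contra! hne
  have hl := (G.l_pos j).ne'
  have hinj := G.π_injOn j
  have h0 := G.zero_mem_Icc j
  have h1 := G.length_mem_Icc j
  have hsub : ({G.π j s, G.π j 0, G.π j (G.l j)} : Set (EuclideanSpace ℝ (Fin n))) ⊆
      G.π j '' Icc 0 (G.l j) ∩ range G.v := by
    rintro x (rfl | rfl | rfl)
    · exact ⟨mem_image_of_mem _ hs, hv⟩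
    · exact ⟨mem_image_of_mem _ h0, G.π_zero_mem j⟩
    · exact ⟨mem_image_of_mem _ h1, G.π_length_mem j⟩
  have hcard := encard_le_encard hsub
  rw [G.encard_vertices j, encard_insert_of_notMem, encard_pair] at hcard
  · exact absurd hcard (by norm_num)
  · exact fun h => hl (hinj h1 h0 h.symm)
  · rintro (h | h)
    · exact hne.1 (hinj hs h0 h)
    · exact hne.2 (hinj hs h1 h)

/-- Points common to two different closed edges are vertices, and these are end-points. -/
lemma edge_eq {j k : J} {s r : ℝ} (hs : s ∈ Ioo 0 (G.l j)) (hr : r ∈ Icc 0 (G.l k))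
    (h : G.π j s = G.π k r) : k = j := by
  by_contra hne
  have hs' := Ioo_subset_Icc_self hs
  have := G.inter_subset j k (Ne.symm hne)
    ⟨mem_image_of_mem _ hs', h ▸ mem_image_of_mem _ hr⟩
  rcases eq_endpoint hs' this with h | h
  · exact hs.1.ne' h
  · exact hs.2.ne h

lemma π_notMem_vertices {j : J} {s : ℝ} (hs : s ∈ Ioo 0 (G.l j)) : G.π j s ∉ range G.v :=
  fun h => (eq_endpoint (Ioo_subset_Icc_self hs) h).elim hs.1.ne' hs.2.ne

lemma boundary_subset_range (B : Set I) : G.boundary B ⊆ range G.v := image_subset_range _ _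

lemma π_mem_interior (B : Set I) {j : J} {s : ℝ} (hs : s ∈ Ioo 0 (G.l j)) :
    G.π j s ∈ G.interior B :=
  ⟨π_mem_carrier (Ioo_subset_Icc_self hs),
    fun h => π_notMem_vertices hs (boundary_subset_range B h)⟩

lemma interior_subset_carrier (B : Set I) : G.interior B ⊆ G.carrier := sdiff_subset

lemma vertex_mem_boundary_iff {B : Set I} {i : I} : G.v i ∈ G.boundary B ↔ i ∈ B :=
  G.v_injective.mem_set_image

lemma vertex_mem_carrier (i : I) : G.v i ∈ G.carrier := by
  obtain ⟨m, p, h, -⟩ := G.connected i i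
  exact closedEdge_subset_carrier _ h

lemma vertex_mem_interior {B : Set I} {i : I} (hi : i ∉ B) : G.v i ∈ G.interior B :=
  ⟨vertex_mem_carrier i, fun h => hi (vertex_mem_boundary_iff.1 h)⟩

lemma boundary_subset_carrier (B : Set I) : G.boundary B ⊆ G.carrier := by
  rintro _ ⟨i, -, rfl⟩
  exact vertex_mem_carrier i

lemma endpoint_mem_range {j : J} {e : ℝ} (he : e = 0 ∨ e = G.l j) : G.π j e ∈ range G.v := by
  rcases he with rfl | rfl
  · exact G.π_zero_mem j
  · exact G.π_length_mem j

lemma endpoint_mem_Icc {j : J} {e : ℝ} (he : e = 0 ∨ e = G.l j) : e ∈ Icc 0 (G.l j) := by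
  rcases he with rfl | rfl
  · exact G.zero_mem_Icc j
  · exact G.length_mem_Icc j

/-- Neighbourhoods in the network are described by the incident edges. -/
lemma eventually_nhdsWithin_carrier [Finite J] {x : EuclideanSpace ℝ (Fin n)}
    {P : EuclideanSpace ℝ (Fin n) → Prop}
    (h : ∀ k, x ∈ G.closedEdge k →
      ∀ᶠ r in 𝓝[Icc 0 (G.l k)] G.coord k x, P (G.π k r)) :
    ∀ᶠ y in 𝓝[G.carrier] x, P y := by
  rw [carrier, nhdsWithin_iUnion, eventually_iSup]
  intro k
  by_cases hx : x ∈ G.closedEdge k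
  · have ht : Tendsto (G.coord k) (𝓝[G.closedEdge k] x) (𝓝[Icc 0 (G.l k)] G.coord k x) :=
      tendsto_nhdsWithin_iff.2 ⟨G.continuousOn_coord k x hx,
        eventually_mem_nhdsWithin.mono fun y hy => coord_mem hy⟩
    filter_upwards [ht.eventually (h k hx), self_mem_nhdsWithin] with y hy hyk
    rwa [π_coord hyk] at hy
  -- A closed edge missing `x` stays away from `x` and imposes no condition.
  · rw [← (G.isCompact_closedEdge k).isClosed.closure_eq, mem_closure_iff_nhdsWithin_neBot,
      not_neBot] at hx
    rw [hx]
    exact eventually_bot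

/-- Here `s` may be the parameter of a vertex: the nearby points to its right are inner points of
the edge, which belong to `Γ` for every `B`. -/
lemma eventually_right {B : Set I} {j : J} {s : ℝ} {P : EuclideanSpace ℝ (Fin n) → Prop}
    (h : ∀ᶠ y in 𝓝[G.interior B] (G.π j s), P y) (hs : s ∈ Icc 0 (G.l j)) (hsl : s < G.l j) :
    ∀ᶠ r in 𝓝[>] s, P (G.π j r) := by
  have hmem : Ioo s (G.l j) ∈ 𝓝[>] s := Ioo_mem_nhdsGT hsl
  refine (tendsto_nhdsWithin_iff.2 ⟨?_, ?_⟩ : Tendsto (G.π j) (𝓝[>] s) _).eventually h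
  · exact (G.continuousOn_π j s hs).mono_left (nhdsWithin_le_of_mem
      (mem_of_superset hmem fun r hr => ⟨hs.1.trans hr.1.le, hr.2.le⟩))
  · filter_upwards [hmem] with r hr using π_mem_interior B ⟨hs.1.trans_lt hr.1, hr.2⟩

lemma eventually_left {B : Set I} {j : J} {s : ℝ} {P : EuclideanSpace ℝ (Fin n) → Prop}
    (h : ∀ᶠ y in 𝓝[G.interior B] (G.π j s), P y) (hs : s ∈ Icc 0 (G.l j)) (hs0 : 0 < s) :
    ∀ᶠ r in 𝓝[<] s, P (G.π j r) := by
  have hmem : Ioo 0 s ∈ 𝓝[<] s := Ioo_mem_nhdsLT hs0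
  refine (tendsto_nhdsWithin_iff.2 ⟨?_, ?_⟩ : Tendsto (G.π j) (𝓝[<] s) _).eventually h
  · exact (G.continuousOn_π j s hs).mono_left (nhdsWithin_le_of_mem
      (mem_of_superset hmem fun r hr => ⟨hr.1.le, hr.2.le.trans hs.2⟩))
  · filter_upwards [hmem] with r hr using π_mem_interior B ⟨hr.1, hr.2.trans_le hs.2⟩

/-- Every continuous function on a closed edge extends to a continuous function on the ambient
space. -/
lemma exists_continuous_extension (j : J) {ψ : ℝ → ℝ} (hψ : Continuous ψ) :
    ∃ φ : EuclideanSpace ℝ (Fin n) → ℝ, Continuous φ ∧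
      ∀ s ∈ Icc 0 (G.l j), φ (G.π j s) = ψ s := by
  have hc : ContinuousOn (ψ ∘ G.coord j) (G.closedEdge j) :=
    hψ.comp_continuousOn (G.continuousOn_coord j)
  obtain ⟨φ, hφ⟩ := ContinuousMap.exists_restrict_eq (G.isCompact_closedEdge j).isClosed
    ⟨_, continuousOn_iff_continuous_domRestrict.1 hc⟩
  refine ⟨φ, φ.continuous, fun s hs => ?_⟩
  have := congrArg (fun F => F ⟨_, π_mem_closedEdge hs⟩) hφ
  simpa [coord_π hs] using this

/-- A one-dimensional test function at an inner point of an edge lifts to the network. -/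
lemma exists_edge_test [Finite J] {j : J} {s d : ℝ} (hs : s ∈ Ioo 0 (G.l j)) {ψ : ℝ → ℝ}
    (hψ : Continuous ψ) (hd : HasDerivAt ψ d s) :
    ∃ φ : EuclideanSpace ℝ (Fin n) → ℝ, Continuous φ ∧ φ (G.π j s) = ψ s ∧ G.DiffAlong φ j (G.π j s) ∧
      G.edgeDeriv φ j (G.π j s) = d ∧
      ∀ P : ℝ → EuclideanSpace ℝ (Fin n) → Prop, (∀ᶠ r in 𝓝 s, P (ψ r) (G.π j r)) →
        ∀ᶠ y in 𝓝[G.carrier] (G.π j s), P (φ y) y := by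
  have hs' := Ioo_subset_Icc_self hs
  obtain ⟨φ, hφc, hφ⟩ := G.exists_continuous_extension j hψ
  have hder : HasDerivWithinAt (φ ∘ G.π j) d (Icc 0 (G.l j)) s :=
    hd.hasDerivWithinAt.congr (fun r hr => hφ r hr) (hφ s hs')
  refine ⟨φ, hφc, hφ s hs', ?_, ?_, fun P hP => eventually_nhdsWithin_carrier fun k hk => ?_⟩
  · rw [DiffAlong, coord_π hs']
    exact hder.differentiableWithinAt
  · rw [edgeDeriv, coord_π hs']
    exact hder.derivWithin (uniqueDiffOn_Icc (G.l_pos j) s hs')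
  -- An inner point lies on no other closed edge, so only the values of `φ` along `j` matter nearby.
  · obtain ⟨r, hr, hrk⟩ := hk
    obtain rfl := edge_eq hs hr hrk.symm
    rw [coord_π hs']
    filter_upwards [mem_nhdsWithin_of_mem_nhds hP, self_mem_nhdsWithin] with t ht htI
    rwa [hφ t htI]

/-! ### Running cost along an edge and its primitive. -/

variable (G) (f : EuclideanSpace ℝ (Fin n) → ℝ)

/-- The running cost along the edge `j` as a function on `ℝ`, constant outside `[0, l j]`. -/
def weight (j : J) (s : ℝ) : ℝ := f (G.π j (projIcc 0 (G.l j) (G.l_pos j).le s))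

/-- The primitive of the running cost along the edge `j`. -/
def potential (j : J) (s : ℝ) : ℝ := ∫ r in (0 : ℝ)..s, G.weight f j r

variable {G f}

lemma weight_eq {j : J} {s : ℝ} (hs : s ∈ Icc 0 (G.l j)) : G.weight f j s = f (G.π j s) := by
  rw [weight, projIcc_of_mem _ hs]

lemma continuous_weight (hf : ContinuousOn f G.carrier) (j : J) : Continuous (G.weight f j) := by
  have h : ContinuousOn (fun s => f (G.π j s)) (Icc 0 (G.l j)) :=
    hf.comp (G.continuousOn_π j) fun s hs => π_mem_carrier hs
  exact (continuousOn_iff_continuous_domRestrict.1 h).comp continuous_projIcc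

lemma hasDerivAt_potential (hf : ContinuousOn f G.carrier) (j : J) (s : ℝ) :
    HasDerivAt (G.potential f j) (G.weight f j s) s :=
  (continuous_weight hf j).integral_hasStrictDerivAt 0 s |>.hasDerivAt

lemma le_weight {η : ℝ} (hη : ∀ x ∈ G.carrier, η ≤ f x) (j : J) (s : ℝ) : η ≤ G.weight f j s :=
  hη _ (π_mem_carrier (Subtype.coe_prop _))

/-- A lower bound of a continuous function on `Γ` extends to `Γ̄`. -/
lemma le_on_carrier {B : Set I} (hf : ContinuousOn f G.carrier) {η : ℝ}
    (hfη : ∀ x ∈ G.interior B, η ≤ f x) : ∀ x ∈ G.carrier, η ≤ f x := by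
  intro x hx
  obtain ⟨j, s, hs, rfl⟩ := mem_iUnion.1 hx
  have h : ContinuousOn (fun s => f (G.π j s)) (Icc 0 (G.l j)) :=
    hf.comp (G.continuousOn_π j) fun s hs => π_mem_carrier hs
  have hcl : s ∈ closure (Ioo 0 (G.l j)) := by rwa [closure_Ioo (G.l_pos j).ne]
  have := mem_closure_iff_nhdsWithin_neBot.1 hcl
  exact ge_of_tendsto ((h s hs).mono_left (nhdsWithin_mono s Ioo_subset_Icc_self))
    (eventually_mem_nhdsWithin.mono fun r hr => hfη _ (π_mem_interior B hr))

end Network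

/-! ### Abstract cost-to-target problems. -/

/-- `Reach T g step x c`: there is a finite chain of steps from `x` to some `y ∈ T` whose total
cost plus `g y` equals `c`. -/
inductive Reach {X : Type*} (T : Set X) (g : X → ℝ) (step : X → X → ℝ → Prop) : X → ℝ → Prop
  | nil {x : X} : x ∈ T → Reach T g step x (g x)
  | cons {x x' : X} {c c' : ℝ} : step x x' c → Reach T g step x' c' → Reach T g step x (c + c')

namespace Reach

variable {X : Type*} {T : Set X} {g : X → ℝ} {step : X → X → ℝ → Prop}

/-- Verification: a function compatible with all steps is below every chain cost. -/
lemma le_of_step {w : X → ℝ} (hT : ∀ x ∈ T, w x ≤ g x)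
    (hw : ∀ x x' c, step x x' c → w x ≤ c + w x') {x : X} {c : ℝ} (h : Reach T g step x c) :
    w x ≤ c := by
  induction h with
  | nil hx => exact hT _ hx
  | cons hs _ ih => linarith [hw _ _ _ hs]

lemma exists_step {x : X} {c : ℝ} (h : Reach T g step x c) (hx : x ∉ T) :
    ∃ x' c₁ c₂, step x x' c₁ ∧ Reach T g step x' c₂ ∧ c = c₁ + c₂ := by
  cases h with
  | nil h => exact absurd h hx
  | cons hs hr => exact ⟨_, _, _, hs, hr, rfl⟩

variable (T g step) in
/-- The value function of a cost-to-target problem. -/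
def value (x : X) : ℝ := sInf {c | Reach T g step x c}

variable {m : ℝ} (hT : ∀ x ∈ T, m ≤ g x) (hstep : ∀ x x' c, step x x' c → 0 ≤ c)

include hT hstep

lemma lower_bound {x : X} {c : ℝ} (h : Reach T g step x c) : m ≤ c :=
  le_of_step (w := fun _ => m) hT (fun x x' c hs => by linarith [hstep _ _ _ hs]) h

lemma value_le {x : X} {c : ℝ} (h : Reach T g step x c) : value T g step x ≤ c :=
  csInf_le ⟨m, fun _ hc => lower_bound hT hstep hc⟩ h

lemma value_le_add {x x' : X} {c : ℝ} (hs : step x x' c) (hne : ∃ c, Reach T g step x' c) :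
    value T g step x ≤ c + value T g step x' := by
  rw [← sub_le_iff_le_add']
  exact le_csInf hne fun c' hc' => by linarith [value_le hT hstep (cons hs hc')]

end Reach

/-! ### The discrete problem and the scheme. -/

namespace Network

variable {n : ℕ} {I J : Type*} (G : Network n I J) (f : EuclideanSpace ℝ (Fin n) → ℝ)

/-- One step of a discrete trajectory, with its cost. -/
def DiscreteStep (h : ℝ) (x x' : EuclideanSpace ℝ (Fin n)) (c : ℝ) : Prop :=
  ∃ j, ∃ a ∈ Icc 0 (G.l j), ∃ b ∈ Icc 0 (G.l j), x = G.π j a ∧ x' = G.π j b ∧ |a - b| ≤ h ∧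
    c = f x * |a - b|

variable {G f} {B : Set I} {g : EuclideanSpace ℝ (Fin n) → ℝ} {h : ℝ}

lemma reach_of_trajectory (hh : 0 < h) {y : EuclideanSpace ℝ (Fin n)} (hy : y ∈ G.boundary B) :
    ∀ (M : ℕ) (x : EuclideanSpace ℝ (Fin n)) (γ : ℕ → EuclideanSpace ℝ (Fin n)) (j : ℕ → J),
      G.IsTrajectory h x y M γ j →
      Reach (G.boundary B) g (G.DiscreteStep f h) x (G.discreteCost f h M γ j + g y) := by
  intro M
  induction M with
  | zero =>
    rintro x γ j ⟨rfl, rfl, -⟩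
    simpa [discreteCost] using Reach.nil hy
  | succ M ih =>
    rintro x γ j ⟨rfl, hyM, hst⟩
    obtain ⟨h0, h1, hv⟩ := hst 0 M.succ_pos
    have hrec := ih (γ 1) (fun m => γ (m + 1)) (fun m => j (m + 1))
      ⟨rfl, hyM, fun m hm => hst (m + 1) (by omega)⟩
    have hq : h * |G.velocity h γ j 0| =
        |G.coord (j 0) (γ 0) - G.coord (j 0) (γ 1)| := by
      rw [velocity, abs_div, abs_of_pos hh, abs_sub_comm]
      field_simp
    have hs : G.DiscreteStep f h (γ 0) (γ 1) (h * f (γ 0) * |G.velocity h γ j 0|) := by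
      refine ⟨j 0, _, coord_mem h0, _, coord_mem h1, (π_coord h0).symm, (π_coord h1).symm, ?_, ?_⟩
      · rw [← hq]
        exact mul_le_of_le_one_right hh.le hv
      · rw [← hq]; ring
    convert Reach.cons hs hrec using 1
    rw [discreteCost, Finset.sum_range_succ']
    simp only [discreteCost, velocity]
    ring

lemma exists_trajectory_of_reach (hh : 0 < h) {x : EuclideanSpace ℝ (Fin n)} {c : ℝ}
    (hr : Reach (G.boundary B) g (G.DiscreteStep f h) x c) (j₀ : J) :
    ∃ y ∈ G.boundary B, ∃ M γ j, G.IsTrajectory h x y M γ j ∧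
      c = G.discreteCost f h M γ j + g y := by
  induction hr with
  -- The empty trajectory uses no edge; `j₀` merely fills the sequence.
  | @nil x hx => exact ⟨x, hx, 0, fun _ => x, fun _ => j₀, ⟨rfl, rfl, by simp⟩, by simp [discreteCost]⟩
  | @cons x x' c c' hs _ ih =>
    obtain ⟨y, hy, M, γ, j, ⟨hγ0, hγM, hst⟩, hc⟩ := ih
    obtain ⟨k, a, ha, b, hb, hxa, hxb, hab, hcost⟩ := hs
    set γ' : ℕ → EuclideanSpace ℝ (Fin n) := fun m => m.casesOn x γ with hγ'
    set j' : ℕ → J := fun m => m.casesOn k j with hj'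
    have hγ'0 : γ' 0 = x := rfl
    have hγ'1 : γ' (0 + 1) = x' := hγ0
    have hj'0 : j' 0 = k := rfl
    have hv : |G.velocity h γ' j' 0| = |a - b| / h := by
      rw [velocity, hγ'0, hγ'1, hj'0, hxa, hxb, coord_π ha, coord_π hb, abs_div, abs_of_pos hh, abs_sub_comm]
    refine ⟨y, hy, M + 1, γ', j', ⟨rfl, hγM, fun m hm => ?_⟩, ?_⟩
    · cases m with
      | zero =>
        refine ⟨?_, ?_, ?_⟩
        · rw [hγ'0, hj'0, hxa]
          exact π_mem_closedEdge ha
        · rw [hγ'1, hj'0, hxb]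
          exact π_mem_closedEdge hb
        · rw [hv]
          exact div_le_one_of_le₀ hab hh.le
      | succ m => exact hst m (by omega)
    · rw [discreteCost, Finset.sum_range_succ', hv, hc, hcost]
      have : h * f (γ' 0) * (|a - b| / h) = f x * |a - b| := by
        rw [hγ'0]
        field_simp
      rw [this, discreteCost]
      simp only [velocity, hγ', hj']
      ring

/-- Replaces indexed sequences by inductive chains, so that dynamic programming becomes removal of
the first step. -/
lemma discreteValue_eq [Nonempty J] (hh : 0 < h) :
    G.discreteValue B f g h = Reach.value (G.boundary B) g (G.DiscreteStep f h) := by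
  funext x
  rw [discreteValue, Reach.value]
  congr 1
  ext c
  constructor
  · rintro ⟨y, hy, M, γ, j, ht, rfl⟩
    exact reach_of_trajectory hh hy M x γ j ht
  · exact fun hr => exists_trajectory_of_reach hh hr (Classical.arbitrary J)

lemma scheme_eq_of_mem {φ : EuclideanSpace ℝ (Fin n) → ℝ} {x : EuclideanSpace ℝ (Fin n)}
    (hx : x ∈ G.boundary B) : G.scheme B f g h φ x = g x := by
  rw [scheme, if_pos hx]

/-- Under `q = (a - b) / h` the admissible controls correspond to the discrete steps leaving `x`. -/
lemma scheme_eq_of_notMem (hh : 0 < h) {φ : EuclideanSpace ℝ (Fin n) → ℝ}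
    {x : EuclideanSpace ℝ (Fin n)} (hx : x ∉ G.boundary B) :
    G.scheme B f g h φ x = sInf {c | ∃ x' c', G.DiscreteStep f h x x' c' ∧ c = c' + φ x'} := by
  rw [scheme, if_neg hx]
  congr 1
  ext c
  constructor
  · rintro ⟨k, hk, q, hq, hmem, rfl⟩
    have habs : |G.coord k x - (G.coord k x - h * q)| = h * |q| := by
      rw [sub_sub_cancel, abs_mul, abs_of_pos hh]
    refine ⟨_, _, ⟨k, _, coord_mem hk, _, hmem, (π_coord hk).symm, rfl, ?_, rfl⟩, ?_⟩
    · rw [habs]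
      exact mul_le_of_le_one_right hh.le (abs_le.2 hq)
    · rw [habs]; ring
  · rintro ⟨x', c', ⟨k, a, ha, b, hb, rfl, rfl, hab, rfl⟩, rfl⟩
    have hmul : h * ((a - b) / h) = a - b := by field_simp
    refine ⟨k, π_mem_closedEdge ha, (a - b) / h, ?_, ?_⟩
    · rw [mem_Icc, ← abs_le, abs_div, abs_of_pos hh]
      exact div_le_one_of_le₀ hab hh.le
    · rw [coord_π ha, hmul, sub_sub_cancel]
      refine ⟨hb, ?_⟩
      rw [abs_div, abs_of_pos hh]
      field_simp
      ring

lemma DiscreteStep.mem_carrier {x x' : EuclideanSpace ℝ (Fin n)} {c : ℝ}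
    (hs : G.DiscreteStep f h x x' c) : x' ∈ G.carrier := by
  obtain ⟨k, a, ha, b, hb, -, rfl, -⟩ := hs
  exact π_mem_carrier hb

lemma DiscreteStep.nonneg (hf : ∀ x ∈ G.carrier, 0 ≤ f x) {x x' : EuclideanSpace ℝ (Fin n)}
    {c : ℝ} (hs : G.DiscreteStep f h x x' c) : 0 ≤ c := by
  obtain ⟨k, a, ha, b, hb, rfl, rfl, -, rfl⟩ := hs
  exact mul_nonneg (hf _ (π_mem_carrier ha)) (abs_nonneg _)

lemma exists_discreteStep_self (hh : 0 < h) {x : EuclideanSpace ℝ (Fin n)} (hx : x ∈ G.carrier) :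
    ∃ c, G.DiscreteStep f h x x c := by
  obtain ⟨j, s, hs, rfl⟩ := mem_iUnion.1 hx
  exact ⟨_, j, s, hs, s, hs, rfl, rfl, by simpa using hh.le, rfl⟩

/-- The value function of the discrete problem solves the scheme. -/
lemma isSchemeSolution_value (hh : 0 < h) (hf : ∀ x ∈ G.carrier, 0 ≤ f x) {m : ℝ}
    (hg : ∀ x ∈ G.boundary B, m ≤ g x)
    (hne : ∀ x ∈ G.carrier, ∃ c, Reach (G.boundary B) g (G.DiscreteStep f h) x c)
    (hbdd : ∃ C, ∀ x ∈ G.carrier,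
      |Reach.value (G.boundary B) g (G.DiscreteStep f h) x| ≤ C)
    (hcomp : ∀ x ∈ G.boundary B,
      g x ≤ Reach.value (G.boundary B) g (G.DiscreteStep f h) x) :
    G.IsSchemeSolution B f g h (Reach.value (G.boundary B) g (G.DiscreteStep f h)) := by
  have hstep : ∀ x x' c, G.DiscreteStep f h x x' c → 0 ≤ c := fun _ _ _ hs => hs.nonneg hf
  refine ⟨hbdd, fun x hx => ?_⟩
  by_cases hxB : x ∈ G.boundary B
  · rw [scheme_eq_of_mem hxB]
    exact le_antisymm (Reach.value_le hg hstep (Reach.nil hxB)) (hcomp x hxB)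
  · rw [scheme_eq_of_notMem hh hxB]
    apply le_antisymm
    · obtain ⟨c, hc⟩ := exists_discreteStep_self (f := f) hh hx
      refine le_csInf ⟨_, x, c, hc, rfl⟩ ?_
      rintro _ ⟨x', c', hs, rfl⟩
      exact Reach.value_le_add hg hstep hs (hne x' hs.mem_carrier)
    · refine le_csInf (hne x hx) fun c hc => ?_
      obtain ⟨x', c₁, c₂, hs, hr, rfl⟩ := hc.exists_step hxB
      refine le_trans (csInf_le ⟨m, ?_⟩ ⟨x', c₁, hs, rfl⟩)
        (add_le_add le_rfl (Reach.value_le hg hstep hr))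
      rintro _ ⟨y, c', hs', rfl⟩
      obtain hl : m ≤ Reach.value (G.boundary B) g (G.DiscreteStep f h) y :=
        le_csInf (hne y hs'.mem_carrier) fun _ hc => Reach.lower_bound hg hstep hc
      linarith [hstep _ _ _ hs']

/-- Every bounded solution of the scheme is below the discrete value function. -/
lemma IsSchemeSolution.le_value (hh : 0 < h) (hf : ∀ x ∈ G.carrier, 0 ≤ f x)
    (hne : ∀ x ∈ G.carrier, ∃ c, Reach (G.boundary B) g (G.DiscreteStep f h) x c) {m : ℝ}
    (hg : ∀ x ∈ G.boundary B, m ≤ g x)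
    (hcomp : ∀ x ∈ G.boundary B,
      g x ≤ Reach.value (G.boundary B) g (G.DiscreteStep f h) x)
    {w : EuclideanSpace ℝ (Fin n) → ℝ} (hw : G.IsSchemeSolution B f g h w) :
    ∀ x ∈ G.carrier, w x ≤ Reach.value (G.boundary B) g (G.DiscreteStep f h) x := by
  obtain ⟨⟨C, hC⟩, hw⟩ := hw
  have hstep : ∀ x x' c, G.DiscreteStep f h x x' c → 0 ≤ c := fun _ _ _ hs => hs.nonneg hf
  intro x hx
  refine le_csInf (hne x hx) fun c (hc : Reach _ _ _ x c) => ?_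
  induction hc with
  | nil hxB => rw [hw _ hx, scheme_eq_of_mem hxB]
  | @cons x x' c c' hs hr ih =>
    -- A chain may meet `∂Γ` before it stops; there `w = g`, and discrete compatibility bounds `g`
    -- by the cost of the rest.
    by_cases hxB : x ∈ G.boundary B
    · rw [hw _ hx, scheme_eq_of_mem hxB]
      exact (hcomp x hxB).trans (Reach.value_le hg hstep (Reach.cons hs hr))
    · rw [hw _ hx, scheme_eq_of_notMem hh hxB]
      refine le_trans (csInf_le ⟨-C, ?_⟩ ⟨x', c, hs, rfl⟩)
        (add_le_add le_rfl (ih hs.mem_carrier))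
      rintro _ ⟨y, c', hs', rfl⟩
      linarith [hstep _ _ _ hs', neg_le_of_abs_le (hC y hs'.mem_carrier)]

end Network

/-! ### The continuous value function. -/

namespace Network

variable {n : ℕ} {I J : Type*} (G : Network n I J) (f : EuclideanSpace ℝ (Fin n) → ℝ)

/-- A move along an edge to one of its end-points, with its cost. -/
def EdgeStep (x x' : EuclideanSpace ℝ (Fin n)) (c : ℝ) : Prop :=
  ∃ j, ∃ a ∈ Icc 0 (G.l j), ∃ e, (e = 0 ∨ e = G.l j) ∧ a ≠ e ∧ x = G.π j a ∧ x' = G.π j e ∧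
    c = |G.potential f j a - G.potential f j e|

variable {G f} {B : Set I} {g : EuclideanSpace ℝ (Fin n) → ℝ}

lemma EdgeStep.mem_range {x x' : EuclideanSpace ℝ (Fin n)} {c : ℝ} (hs : G.EdgeStep f x x' c) :
    x' ∈ range G.v := by
  obtain ⟨j, a, ha, e, he, -, -, rfl, -⟩ := hs
  exact endpoint_mem_range he

lemma EdgeStep.mem_carrier {x x' : EuclideanSpace ℝ (Fin n)} {c : ℝ} (hs : G.EdgeStep f x x' c) :
    x' ∈ G.carrier := by
  obtain ⟨j, a, ha, e, he, -, -, rfl, -⟩ := hs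
  exact π_mem_carrier (endpoint_mem_Icc he)

lemma EdgeStep.nonneg {x x' : EuclideanSpace ℝ (Fin n)} {c : ℝ} (hs : G.EdgeStep f x x' c) :
    0 ≤ c := by
  obtain ⟨j, a, ha, e, he, -, -, -, rfl⟩ := hs
  exact abs_nonneg _

/-- The clause `a ≠ e` in `EdgeStep` serves this strict inequality, on which the comparison at
vertices rests. -/
lemma EdgeStep.pos (hf : ContinuousOn f G.carrier) {η : ℝ} (hη : 0 < η)
    (hfη : ∀ x ∈ G.carrier, η ≤ f x) {x x' : EuclideanSpace ℝ (Fin n)} {c : ℝ}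
    (hs : G.EdgeStep f x x' c) : 0 < c := by
  obtain ⟨j, a, ha, e, he, hae, -, -, rfl⟩ := hs
  have hw : ∀ s, 0 < G.weight f j s := fun s => hη.trans_le (le_weight hfη j s)
  obtain ⟨r, -, hr⟩ := exists_abs_sub_eq_mul (hasDerivAt_potential hf j) hw a e
  rw [hr]
  exact mul_pos (hw r) (abs_pos.2 (sub_ne_zero.2 hae))

lemma exists_reach_of_vertex {j : J} {y : EuclideanSpace ℝ (Fin n)} (hy : y ∈ G.closedEdge j)
    (hyv : y ∈ range G.v) (hr : ∃ c, Reach (G.boundary B) g (G.EdgeStep f) y c)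
    {x : EuclideanSpace ℝ (Fin n)} (hx : x ∈ G.closedEdge j) :
    ∃ c, Reach (G.boundary B) g (G.EdgeStep f) x c := by
  obtain ⟨e, he, rfl⟩ := hy
  obtain ⟨a, ha, rfl⟩ := hx
  by_cases hae : a = e
  · rwa [hae]
  · obtain ⟨c, hc⟩ := hr
    exact ⟨_, Reach.cons ⟨j, a, ha, e, eq_endpoint he hyv, hae, rfl, rfl, rfl⟩ hc⟩

/-- The boundary can be reached from every point. -/
lemma exists_reach (hB : B.Nonempty) {x : EuclideanSpace ℝ (Fin n)} (hx : x ∈ G.carrier) :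
    ∃ c, Reach (G.boundary B) g (G.EdgeStep f) x c := by
  obtain ⟨j, hxj⟩ := mem_iUnion.1 hx
  obtain ⟨i', hi'⟩ := hB
  obtain ⟨i, hi⟩ := G.π_zero_mem j
  obtain ⟨m, p, h0, hm, hp⟩ := G.connected i i'
  -- Backward induction from the edge containing the boundary vertex; distinct consecutive edges
  -- meet at a vertex, which serves as the intermediate target.
  have key : ∀ r : Fin (m + 1), ∀ y ∈ G.closedEdge (p r),
      ∃ c, Reach (G.boundary B) g (G.EdgeStep f) y c := by
    intro r
    induction r using Fin.reverseInduction with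
    | last =>
      exact fun y hy => exists_reach_of_vertex (y := G.v i') hm (mem_range_self _)
        ⟨_, Reach.nil (mem_image_of_mem _ hi')⟩ hy
    | cast r ih =>
      obtain ⟨z, hz⟩ : (G.closedEdge (p r.castSucc) ∩ G.closedEdge (p r.succ)).Nonempty := by
        rw [nonempty_iff_ne_empty]
        intro he
        have := hp r
        rw [closedEdge, closedEdge] at he
        simp [he] at this
      by_cases hrr : p r.castSucc = p r.succ
      · rwa [hrr]
      · exact fun y hy => exists_reach_of_vertex hz.1
          (G.inter_subset _ _ hrr hz) (ih z hz.2) hy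
  exact exists_reach_of_vertex (π_mem_closedEdge (G.zero_mem_Icc j)) (G.π_zero_mem j)
    (hi ▸ key 0 (G.v i) h0) hxj

/-- The value function of the continuous problem. -/
def contValue (G : Network n I J) (B : Set I) (f g : EuclideanSpace ℝ (Fin n) → ℝ) :
    EuclideanSpace ℝ (Fin n) → ℝ :=
  Reach.value (G.boundary B) g (G.EdgeStep f)

lemma contValue_le_boundary {m : ℝ} (hg : ∀ x ∈ G.boundary B, m ≤ g x)
    {x : EuclideanSpace ℝ (Fin n)} (hx : x ∈ G.boundary B) : G.contValue B f g x ≤ g x :=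
  Reach.value_le hg (fun _ _ _ hs => hs.nonneg) (Reach.nil hx)

lemma contValue_le_add (hB : B.Nonempty) {m : ℝ} (hg : ∀ x ∈ G.boundary B, m ≤ g x)
    {x x' : EuclideanSpace ℝ (Fin n)} {c : ℝ} (hs : G.EdgeStep f x x' c) :
    G.contValue B f g x ≤ c + G.contValue B f g x' :=
  Reach.value_le_add hg (fun _ _ _ hs => hs.nonneg) hs (exists_reach hB hs.mem_carrier)

/-- A move from `x` is determined by its edge and end-point; finiteness makes the optimal first move
attained. -/
lemma finite_edgeStep [Finite J] (w : EuclideanSpace ℝ (Fin n) → ℝ)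
    (x : EuclideanSpace ℝ (Fin n)) :
    {c | ∃ x' c', G.EdgeStep f x x' c' ∧ c = c' + w x'}.Finite := by
  let F : J → ℝ → ℝ := fun j e =>
    |G.potential f j (G.coord j x) - G.potential f j e| + w (G.π j e)
  refine ((finite_range fun j => F j 0).union (finite_range fun j => F j (G.l j))).subset ?_
  rintro _ ⟨x', c', ⟨j, a, ha, e, he, -, rfl, rfl, rfl⟩, rfl⟩
  rcases he with rfl | rfl
  · exact Or.inl ⟨j, by simp only [F, coord_π ha]⟩
  · exact Or.inr ⟨j, by simp only [F, coord_π ha]⟩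

/-- Dynamic programming with an optimal first step. -/
lemma exists_contValue_eq [Finite J] (hB : B.Nonempty) {m : ℝ}
    (hg : ∀ x ∈ G.boundary B, m ≤ g x) {x : EuclideanSpace ℝ (Fin n)} (hx : x ∈ G.interior B) :
    ∃ x' c, G.EdgeStep f x x' c ∧ c + G.contValue B f g x' ≤ G.contValue B f g x := by
  have hne := exists_reach (f := f) (g := g) hB hx.1
  obtain ⟨c₀, hc₀⟩ := hne
  obtain ⟨x₀, c₁, c₂, hs₀, -, -⟩ := hc₀.exists_step hx.2
  obtain ⟨_, ⟨x', c', hs, rfl⟩, hmin⟩ := exists_min_image _ id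
    (finite_edgeStep (f := f) (G.contValue B f g) x) ⟨_, x₀, c₁, hs₀, rfl⟩
  refine ⟨x', c', hs, le_csInf ⟨c₀, hc₀⟩ fun c hc => ?_⟩
  obtain ⟨y, c₁, c₂, hs', hr, rfl⟩ := Reach.exists_step hc hx.2
  exact (hmin _ ⟨y, c₁, hs', rfl⟩).trans
    (add_le_add le_rfl (Reach.value_le hg (fun _ _ _ hs => hs.nonneg) hr))

lemma contValue_le_endpoint (hB : B.Nonempty) {m : ℝ} (hg : ∀ x ∈ G.boundary B, m ≤ g x)
    {j : J} {a e : ℝ} (ha : a ∈ Icc 0 (G.l j)) (he : e = 0 ∨ e = G.l j) :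
    G.contValue B f g (G.π j a) ≤
      |G.potential f j a - G.potential f j e| + G.contValue B f g (G.π j e) := by
  by_cases hae : a = e
  · simp [hae]
  · exact contValue_le_add hB hg ⟨j, a, ha, e, he, hae, rfl, rfl, rfl⟩

lemma exists_endpoint_contValue [Finite J] (hB : B.Nonempty) {m : ℝ}
    (hg : ∀ x ∈ G.boundary B, m ≤ g x) {j : J} {s : ℝ} (hs : s ∈ Ioo 0 (G.l j)) :
    ∃ e, (e = 0 ∨ e = G.l j) ∧ s ≠ e ∧ |G.potential f j s - G.potential f j e| +
      G.contValue B f g (G.π j e) ≤ G.contValue B f g (G.π j s) := by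
  obtain ⟨x', c, ⟨k, a, ha, e, he, hae, hx, rfl, rfl⟩, hle⟩ :=
    exists_contValue_eq (f := f) hB hg (π_mem_interior B hs)
  obtain rfl := edge_eq hs ha hx
  obtain rfl := G.π_injOn k (Ioo_subset_Icc_self hs) ha hx
  exact ⟨e, he, hae, hle⟩

/-- From an inner point `b` some end-point `e` is optimal; going from `a` straight to `e` costs no
more than passing through `b`. -/
lemma contValue_le_of_edge [Finite J] (hB : B.Nonempty) {m : ℝ}
    (hg : ∀ x ∈ G.boundary B, m ≤ g x) {j : J} {a b : ℝ} (ha : a ∈ Icc 0 (G.l j))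
    (hb : b ∈ Icc 0 (G.l j)) :
    G.contValue B f g (G.π j a) ≤
      |G.potential f j a - G.potential f j b| + G.contValue B f g (G.π j b) := by
  by_cases hbe : b = 0 ∨ b = G.l j
  · exact contValue_le_endpoint hB hg ha hbe
  · have hb' : b ∈ Ioo 0 (G.l j) := by
      push Not at hbe
      exact ⟨lt_of_le_of_ne hb.1 hbe.1.symm, lt_of_le_of_ne hb.2 hbe.2⟩
    obtain ⟨e, he, -, hle⟩ := exists_endpoint_contValue (f := f) hB hg hb'
    have := contValue_le_endpoint (f := f) hB hg ha he
    have := abs_sub_le (G.potential f j a) (G.potential f j b) (G.potential f j e)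
    linarith

lemma abs_contValue_sub_le [Finite J] (hB : B.Nonempty) {m : ℝ}
    (hg : ∀ x ∈ G.boundary B, m ≤ g x) {j : J} {a b : ℝ} (ha : a ∈ Icc 0 (G.l j))
    (hb : b ∈ Icc 0 (G.l j)) :
    |G.contValue B f g (G.π j a) - G.contValue B f g (G.π j b)| ≤
      |G.potential f j a - G.potential f j b| := by
  have h1 := contValue_le_of_edge (f := f) hB hg ha hb
  have h2 := contValue_le_of_edge (f := f) hB hg hb ha
  rw [abs_sub_comm] at h2
  exact abs_le.2 ⟨by linarith, by linarith⟩

/-- The closed edges form a finite closed cover, and on each the modulus is that of the primitive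
composed with the coordinate. -/
lemma continuousOn_of_abs_sub_le [Finite J] (hf : ContinuousOn f G.carrier)
    {w : EuclideanSpace ℝ (Fin n) → ℝ}
    (hw : ∀ j, ∀ a ∈ Icc 0 (G.l j), ∀ b ∈ Icc 0 (G.l j),
      |w (G.π j a) - w (G.π j b)| ≤ |G.potential f j a - G.potential f j b|) :
    ContinuousOn w G.carrier := by
  refine (locallyFinite_of_finite _).continuousOn_iUnion
    (fun j => (G.isCompact_closedEdge j).isClosed) fun j x hx => ?_
  have hp : ContinuousWithinAt (fun y => G.potential f j (G.coord j y)) (G.closedEdge j) x :=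
    (hasDerivAt_potential hf j _).continuousAt.comp_continuousWithinAt
      (G.continuousOn_coord j x hx)
  rw [Metric.continuousWithinAt_iff] at hp ⊢
  intro ε hε
  obtain ⟨δ, hδ, h⟩ := hp ε hε
  refine ⟨δ, hδ, fun y hy hyx => (?_ : dist (w y) (w x) ≤ _).trans_lt (h hy hyx)⟩
  have := hw j _ (coord_mem hy) _ (coord_mem hx)
  rwa [π_coord hy, π_coord hx] at this

end Network

/-! ### Viscosity properties from growth and descent along edges. -/

namespace Network

variable {n : ℕ} {I J : Type*} {G : Network n I J} {f : EuclideanSpace ℝ (Fin n) → ℝ}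
  {B : Set I} {w φ : EuclideanSpace ℝ (Fin n) → ℝ}

lemma DiffAlong.hasDerivWithinAt {j : J} {s : ℝ} (hs : s ∈ Icc 0 (G.l j))
    (h : G.DiffAlong φ j (G.π j s)) :
    HasDerivWithinAt (φ ∘ G.π j) (G.edgeDeriv φ j (G.π j s)) (Icc 0 (G.l j)) s := by
  rw [DiffAlong, coord_π hs] at h
  rw [edgeDeriv, coord_π hs]
  exact h.hasDerivWithinAt

lemma monotone_potential (hf : ContinuousOn f G.carrier) (hf0 : ∀ x ∈ G.carrier, 0 ≤ f x) (j : J) :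
    Monotone (G.potential f j) :=
  monotone_of_deriv_nonneg (fun s => (hasDerivAt_potential hf j s).differentiableAt) fun s => by
    rw [(hasDerivAt_potential hf j s).deriv]
    exact le_weight hf0 j s

lemma abs_sign_eq_one {i : I} {j : J} (hj : j ∈ G.Inc i) : |G.sign i j| = 1 := by
  obtain ⟨a, ha, hv⟩ := hj
  rw [sign]
  by_cases h0 : G.π j 0 = G.v i
  · simp [h0]
  · rcases eq_endpoint ha (hv ▸ mem_range_self i) with rfl | rfl
    · exact absurd hv h0
    · simp [h0, hv]

variable (G f w) in
/-- `w` grows along each edge at most as the primitive of `f`. -/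
def EdgeLipschitz : Prop :=
  ∀ j, ∀ a ∈ Icc 0 (G.l j), ∀ b ∈ Icc 0 (G.l j),
    |w (G.π j a) - w (G.π j b)| ≤ |G.potential f j a - G.potential f j b|

section Sub

variable (hf : ContinuousOn f G.carrier) (hf0 : ∀ x ∈ G.carrier, 0 ≤ f x)
  (hw : G.EdgeLipschitz f w)

include hf hf0 hw

/-- By the growth bound `w` plus the primitive is nondecreasing, so at a maximum of `w - φ` the sum
of `φ` and the primitive is minimal from the right. The next lemma is the mirror image. -/
lemma neg_le_edgeDeriv_of_isLocalMaxOn {j : J} {s : ℝ} (hs : s ∈ Icc 0 (G.l j)) (hsl : s < G.l j)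
    (hφ : G.DiffAlong φ j (G.π j s))
    (hmax : IsLocalMaxOn (fun y => w y - φ y) (G.interior B) (G.π j s)) :
    -f (G.π j s) ≤ G.edgeDeriv φ j (G.π j s) := by
  have hd := (hφ.hasDerivWithinAt hs).add (hasDerivAt_potential hf j s).hasDerivWithinAt
  have := deriv_nonneg_of_eventually_right hd hs.1 hsl ?_
  · rw [weight_eq hs] at this
    linarith
  · filter_upwards [eventually_right hmax hs hsl, Ioo_mem_nhdsGT hsl] with r hr hrI
    have h1 := hw j r ⟨hs.1.trans hrI.1.le, hrI.2.le⟩ s hs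
    rw [abs_of_nonneg (sub_nonneg.2 (monotone_potential hf hf0 j hrI.1.le))] at h1
    have := neg_le_of_abs_le h1
    simp only [Pi.add_apply, Function.comp_apply]
    linarith

lemma edgeDeriv_le_of_isLocalMaxOn {j : J} {s : ℝ} (hs : s ∈ Icc 0 (G.l j)) (hs0 : 0 < s)
    (hφ : G.DiffAlong φ j (G.π j s))
    (hmax : IsLocalMaxOn (fun y => w y - φ y) (G.interior B) (G.π j s)) :
    G.edgeDeriv φ j (G.π j s) ≤ f (G.π j s) := by
  have hd := (hφ.hasDerivWithinAt hs).sub (hasDerivAt_potential hf j s).hasDerivWithinAt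
  have := deriv_nonpos_of_eventually_left hd hs0 hs.2 ?_
  · rw [weight_eq hs] at this
    linarith
  · filter_upwards [eventually_left hmax hs hs0, Ioo_mem_nhdsLT hs0] with r hr hrI
    have h1 := hw j s hs r ⟨hrI.1.le, hrI.2.le.trans hs.2⟩
    rw [abs_of_nonneg (sub_nonneg.2 (monotone_potential hf hf0 j hrI.2.le))] at h1
    have := le_of_abs_le h1
    simp only [Pi.sub_apply, Function.comp_apply]
    linarith

/-- The sign turns `∂_j φ` into the derivative pointing from the vertex into the edge, so both
end-points give the same bound. -/
lemma neg_le_sign_mul_edgeDeriv {i : I} {j : J} (hj : j ∈ G.Inc i)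
    (hφ : G.DiffAlong φ j (G.v i))
    (hmax : IsLocalMaxOn (fun y => w y - φ y) (G.interior B) (G.v i)) :
    -f (G.v i) ≤ G.sign i j * G.edgeDeriv φ j (G.v i) := by
  obtain ⟨a, ha, hv⟩ := hj
  have hl := G.l_pos j
  rcases eq_endpoint ha (hv ▸ mem_range_self i) with rfl | rfl
  · rw [sign, if_pos hv, one_mul]
    rw [← hv] at hφ hmax ⊢
    exact neg_le_edgeDeriv_of_isLocalMaxOn hf hf0 hw ha hl hφ hmax
  · have h0 : G.π j 0 ≠ G.v i := fun h =>
      hl.ne (G.π_injOn j (G.zero_mem_Icc j) ha (h.trans hv.symm))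
    rw [sign, if_neg h0, if_pos hv]
    rw [← hv] at hφ hmax ⊢
    linarith [edgeDeriv_le_of_isLocalMaxOn hf hf0 hw ha hl hφ hmax]

/-- Functions with the growth bound along the edges are viscosity subsolutions. -/
lemma EdgeLipschitz.isSubsolution [Finite J] : G.IsSubsolution B f w := by
  refine ⟨(continuousOn_of_abs_sub_le hf hw).upperSemicontinuousOn, ?_, ?_⟩
  · rintro j _ ⟨s, hs, rfl⟩ φ - hφ hmax
    have hs' := Ioo_subset_Icc_self hs
    exact sub_nonpos.2 (abs_le.2 ⟨neg_le_edgeDeriv_of_isLocalMaxOn hf hf0 hw hs' hs.2 hφ hmax,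
      edgeDeriv_le_of_isLocalMaxOn hf hf0 hw hs' hs.1 hφ hmax⟩)
  · rintro i - j hj k hk - φ - ⟨hφj, hφk, hpair⟩ hmax
    have h1 := neg_le_sign_mul_edgeDeriv hf hf0 hw hj hφj hmax
    have h2 := neg_le_sign_mul_edgeDeriv hf hf0 hw hk hφk hmax
    -- The two inward slopes sum to zero, so a lower bound for one is an upper bound for the other.
    have h3 : |G.sign i j * G.edgeDeriv φ j (G.v i)| ≤ f (G.v i) :=
      abs_le.2 ⟨h1, by linarith⟩
    rw [abs_mul, abs_sign_eq_one hj, one_mul] at h3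
    linarith

/-- Full descent to `e` together with the growth bound forces `w` to fall at the exact rate `f` all
the way towards `e`; `φ`, touching from below, falls at least as fast. -/
lemma le_abs_edgeDeriv_of_isLocalMinOn {j : J} {s e : ℝ} (hs : s ∈ Icc 0 (G.l j))
    (he : e = 0 ∨ e = G.l j) (hse : s ≠ e)
    (hdesc : |G.potential f j s - G.potential f j e| + w (G.π j e) ≤ w (G.π j s))
    (hφ : G.DiffAlong φ j (G.π j s))
    (hmin : IsLocalMinOn (fun y => w y - φ y) (G.interior B) (G.π j s)) :
    f (G.π j s) ≤ |G.edgeDeriv φ j (G.π j s)| := by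
  have hmono := monotone_potential hf hf0 j
  rcases he with rfl | rfl
  · have hs0 : 0 < s := lt_of_le_of_ne hs.1 hse.symm
    have hd := (hasDerivAt_potential hf j s).hasDerivWithinAt.sub (hφ.hasDerivWithinAt hs)
    have := deriv_nonpos_of_eventually_left hd hs0 hs.2 ?_
    · rw [weight_eq hs] at this
      linarith [le_abs_self (G.edgeDeriv φ j (G.π j s))]
    · filter_upwards [eventually_left hmin hs hs0, Ioo_mem_nhdsLT hs0] with r hr hrI
      have h1 := hw j r ⟨hrI.1.le, hrI.2.le.trans hs.2⟩ 0 (G.zero_mem_Icc j)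
      rw [abs_of_nonneg (sub_nonneg.2 (hmono hrI.1.le))] at h1
      rw [abs_of_nonneg (sub_nonneg.2 (hmono hs.1))] at hdesc
      have := le_of_abs_le h1
      simp only [Pi.sub_apply, Function.comp_apply]
      linarith
  · have hsl : s < G.l j := lt_of_le_of_ne hs.2 hse
    have hd := ((hφ.hasDerivWithinAt hs).add
      (hasDerivAt_potential hf j s).hasDerivWithinAt).neg
    have := deriv_nonneg_of_eventually_right hd hs.1 hsl ?_
    · rw [weight_eq hs] at this
      linarith [neg_le_abs (G.edgeDeriv φ j (G.π j s))]
    · filter_upwards [eventually_right hmin hs hsl, Ioo_mem_nhdsGT hsl] with r hr hrI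
      have h1 := hw j r ⟨hs.1.trans hrI.1.le, hrI.2.le⟩ _ (G.length_mem_Icc j)
      rw [abs_of_nonpos (sub_nonpos.2 (hmono hrI.2.le))] at h1
      rw [abs_of_nonpos (sub_nonpos.2 (hmono hs.2))] at hdesc
      have := le_of_abs_le h1
      simp only [Pi.neg_apply, Pi.add_apply, Function.comp_apply]
      linarith

/-- Functions with the growth bound and with a descending edge at each point of `Γ` are viscosity
supersolutions. -/
lemma EdgeLipschitz.isSupersolution [Finite J]
    (hB : ∀ i, (G.Inc i).encard = 1 → i ∈ B)
    (hdesc : ∀ x ∈ G.interior B, ∃ x' c, G.EdgeStep f x x' c ∧ c + w x' ≤ w x) :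
    G.IsSupersolution B f w := by
  refine ⟨(continuousOn_of_abs_sub_le hf hw).lowerSemicontinuousOn, ?_, ?_⟩
  · rintro j _ ⟨s, hs, rfl⟩ φ - hφ hmin
    obtain ⟨x', c, ⟨k, a, ha, e, he, hae, hx, rfl, rfl⟩, hle⟩ := hdesc _ (π_mem_interior B hs)
    obtain rfl := edge_eq hs ha hx
    rw [hx] at hφ hmin hle ⊢
    exact sub_nonneg.2 (le_abs_edgeDeriv_of_isLocalMinOn hf hf0 hw ha he hae hle hφ hmin)
  · intro i hi j hj
    obtain ⟨x', c, ⟨k₀, a, ha, e, he, hae, hx, rfl, rfl⟩, hle⟩ := hdesc _ (vertex_mem_interior hi)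
    have hk₀ : k₀ ∈ G.Inc i := by
      rw [Inc, mem_ofPred_eq, hx]
      exact π_mem_closedEdge ha
    have hmain : ∀ φ, G.DiffAlong φ k₀ (G.v i) →
        IsLocalMinOn (fun y => w y - φ y) (G.interior B) (G.v i) →
        f (G.v i) ≤ |G.edgeDeriv φ k₀ (G.v i)| := by
      intro φ hφ hmin
      rw [hx] at hφ hmin hle ⊢
      exact le_abs_edgeDeriv_of_isLocalMinOn hf hf0 hw ha he hae hle hφ hmin
    -- If `j` itself descends, any other incident edge will do, and one exists since `i ∉ B`.
    -- Otherwise the descending edge is the feasible one, and pair differentiability equates the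
    -- moduli of the two slopes.
    by_cases hjk : j = k₀
    · subst hjk
      obtain ⟨k, hk, hkj⟩ : ∃ k ∈ G.Inc i, k ≠ j := by
        by_contra! hall
        refine hi (hB i (encard_eq_one.2 ⟨j, ?_⟩))
        exact eq_singleton_iff_unique_mem.2 ⟨hj, hall⟩
      exact ⟨k, hk, hkj, fun φ _ hφ hmin => sub_nonneg.2 (hmain φ hφ.1 hmin)⟩
    · refine ⟨k₀, hk₀, Ne.symm hjk, fun φ _ hφ hmin => sub_nonneg.2 ?_⟩
      have h1 := hmain φ hφ.2.1 hmin
      have h2 := congrArg abs (eq_neg_of_add_eq_zero_left hφ.2.2)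
      rw [abs_neg, abs_mul, abs_mul, abs_sign_eq_one hj, abs_sign_eq_one hk₀, one_mul,
        one_mul] at h2
      rwa [h2]

end Sub

/-! ### Comparison and uniqueness. -/

section Uniqueness

variable (hf : ContinuousOn f G.carrier) {η : ℝ} (hη : 0 < η) (hfη : ∀ x ∈ G.carrier, η ≤ f x)

include hf

/-- Converse of `EdgeLipschitz.isSubsolution`. Tests at inner points of edges suffice; end-points
are covered by continuity. -/
lemma IsSubsolution.edgeLipschitz [Finite J] (hwc : ContinuousOn w G.carrier)
    (hsub : G.IsSubsolution B f w) : G.EdgeLipschitz f w := by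
  intro j a ha b hb
  refine abs_sub_le_of_upper_tests (W := fun s => w (G.π j s))
    (hwc.comp (G.continuousOn_π j) fun s hs => π_mem_carrier hs)
    (hasDerivAt_potential hf j) (fun s hs ψ d hψ hd hmax => ?_) ha hb
  obtain ⟨φ, hφc, heq, hφd, rfl, hφ⟩ := exists_edge_test hs hψ hd
  have hs' := Ioo_subset_Icc_self hs
  have h1 := hφ (fun t y => w y - t ≤ w (G.π j s) - ψ s) hmax
  have hloc : IsLocalMaxOn (fun y => w y - φ y) (G.interior B) (G.π j s) := by
    refine Eventually.filter_mono (nhdsWithin_mono _ (interior_subset_carrier B)) ?_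
    simpa [heq] using h1
  have := hsub.2.1 j _ (mem_image_of_mem _ hs) φ hφc.continuousOn hφd hloc
  rw [weight_eq hs']
  linarith

include hη hfη

/-- On an edge a supersolution dominates the value function of its end-point values. -/
lemma IsSupersolution.exists_endpoint [Finite J] (hwc : ContinuousOn w G.carrier)
    (hsup : G.IsSupersolution B f w) {j : J} {s : ℝ} (hs : s ∈ Ioo 0 (G.l j)) :
    ∃ e, (e = 0 ∨ e = G.l j) ∧
      w (G.π j e) + |G.potential f j s - G.potential f j e| ≤ w (G.π j s) := by
  have := le_of_lower_tests (W := fun s => w (G.π j s))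
    (hwc.comp (G.continuousOn_π j) fun s hs => π_mem_carrier hs)
    (hasDerivAt_potential hf j) (fun s => hη.trans_le (le_weight hfη j s))
    (fun s hs ψ d hψ hd hmin => ?_) hs
  · rcases this with h | h
    · exact ⟨0, Or.inl rfl, h⟩
    · exact ⟨G.l j, Or.inr rfl, h⟩
  · obtain ⟨φ, hφc, heq, hφd, rfl, hφ⟩ := exists_edge_test hs hψ hd
    have hs' := Ioo_subset_Icc_self hs
    have h1 := hφ (fun t y => w (G.π j s) - ψ s ≤ w y - t) hmin
    have hloc : IsLocalMinOn (fun y => w y - φ y) (G.interior B) (G.π j s) := by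
      refine Eventually.filter_mono (nhdsWithin_mono _ (interior_subset_carrier B)) ?_
      simpa [heq] using h1
    have := hsup.2.1 j _ (mem_image_of_mem _ hs) φ hφc.continuousOn hφd hloc
    rw [weight_eq hs']
    linarith

/-- At a transition vertex a supersolution descends along one of the incident edges. -/
lemma IsSupersolution.exists_edgeStep_vertex [Finite J] (hwc : ContinuousOn w G.carrier)
    (hsup : G.IsSupersolution B f w) {i : I} (hi : i ∉ B) :
    ∃ x' c, G.EdgeStep f (G.v i) x' c ∧ c + w x' ≤ w (G.v i) := by
  by_contra! hno
  -- Near the vertex, `w` dominates the cost through one end of the edge. Through the vertex itself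
  -- this gives the claim; through the far end, the strict gap in `hno` persists by continuity.
  have hmin : ∀ᶠ y in 𝓝[G.carrier] (G.v i), w (G.v i) ≤ w y := by
    refine eventually_nhdsWithin_carrier fun k hk => ?_
    obtain ⟨a, ha, hv⟩ := hk
    rw [← hv] at hno ⊢
    rw [coord_π ha]
    have hae := eq_endpoint ha (hv ▸ mem_range_self i)
    obtain ⟨e, he, hae', hends⟩ : ∃ e, (e = 0 ∨ e = G.l k) ∧ a ≠ e ∧
        ∀ e', (e' = 0 ∨ e' = G.l k) → e' = a ∨ e' = e := by
      have hl := G.l_pos k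
      rcases hae with rfl | rfl
      · exact ⟨G.l k, Or.inr rfl, hl.ne, fun e' h => h⟩
      · exact ⟨0, Or.inl rfl, hl.ne', fun e' h => h.symm⟩
    have hgap := hno _ _ ⟨k, a, ha, e, he, hae', rfl, rfl, rfl⟩
    have hcont : ContinuousAt
        (fun r => |G.potential f k r - G.potential f k e| + w (G.π k e)) a :=
      (((hasDerivAt_potential hf k a).continuousAt.sub continuousAt_const).abs).add
        continuousAt_const
    filter_upwards [mem_nhdsWithin_of_mem_nhds (hcont.eventually (lt_mem_nhds hgap)),
      self_mem_nhdsWithin] with r hr hrI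
    by_cases hre : r = 0 ∨ r = G.l k
    · rcases hends r hre with rfl | rfl
      · exact le_rfl
      · simp only [sub_self, abs_zero, zero_add] at hr
        exact hr.le
    · push Not at hre
      obtain ⟨e', he', hle⟩ := hsup.exists_endpoint hf hη hfη hwc
        (⟨lt_of_le_of_ne hrI.1 hre.1.symm, lt_of_le_of_ne hrI.2 hre.2⟩ : r ∈ Ioo 0 (G.l k))
      rcases hends e' he' with rfl | rfl
      · linarith [abs_nonneg (G.potential f k r - G.potential f k e')]
      · linarith
  obtain ⟨k, hk⟩ := mem_iUnion.1 (vertex_mem_carrier (G := G) i)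
  obtain ⟨k', -, -, hk'⟩ := hsup.2.2 i hi k hk
  have hd : ∀ j, G.edgeDeriv (fun _ => 0) j (G.v i) = 0 := fun j => by
    simp [edgeDeriv, Function.comp_def]
  have := hk' (fun _ => 0) continuousOn_const
    ⟨differentiableWithinAt_const (0 : ℝ), differentiableWithinAt_const (0 : ℝ), by simp [hd]⟩ (by
      refine Eventually.filter_mono (nhdsWithin_mono _ (interior_subset_carrier B)) ?_
      simpa using hmin)
  rw [hd, abs_zero] at this
  linarith [hfη _ (vertex_mem_carrier (G := G) i)]

/-- Comparison: a continuous supersolution with boundary values above `g` dominates every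
function that is compatible with the moves along edges. -/
lemma IsSupersolution.ge_of_edgeStep [Finite I] [Finite J] (hwc : ContinuousOn w G.carrier)
    (hsup : G.IsSupersolution B f w) {u : EuclideanSpace ℝ (Fin n) → ℝ}
    (hu : ∀ x x' c, G.EdgeStep f x x' c → u x ≤ c + u x')
    (hbd : ∀ x ∈ G.boundary B, u x ≤ w x) : ∀ x ∈ G.carrier, u x ≤ w x := by
  have hvert : ∀ i, u (G.v i) ≤ w (G.v i) := by
    by_contra! hbad
    -- At a bad vertex with least `w`, the descending move leads to another bad vertex with strictly
    -- smaller `w`.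
    obtain ⟨i, hi, hmin⟩ := exists_min_image {i | w (G.v i) < u (G.v i)} (fun i => w (G.v i))
      (toFinite _) hbad
    have hiB : i ∉ B := fun h => hi.not_ge (hbd _ (mem_image_of_mem _ h))
    obtain ⟨x', c, hs, hle⟩ := hsup.exists_edgeStep_vertex hf hη hfη hwc hiB
    obtain ⟨i', rfl⟩ := hs.mem_range
    have hc := hs.pos hf hη hfη
    have h1 := hu _ _ _ hs
    have hi : w (G.v i) < u (G.v i) := hi
    have h2 : w (G.v i) ≤ w (G.v i') := hmin i' (show w (G.v i') < u (G.v i') by linarith)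
    linarith
  intro x hx
  obtain ⟨j, s, hs, rfl⟩ := mem_iUnion.1 hx
  by_cases hse : s = 0 ∨ s = G.l j
  · obtain ⟨i, hi⟩ := endpoint_mem_range hse
    exact hi ▸ hvert i
  · push Not at hse
    obtain ⟨e, he, hle⟩ := hsup.exists_endpoint hf hη hfη hwc
      (⟨lt_of_le_of_ne hs.1 hse.1.symm, lt_of_le_of_ne hs.2 hse.2⟩ : s ∈ Ioo 0 (G.l j))
    obtain ⟨i, hi⟩ := endpoint_mem_range he
    have hse' : s ≠ e := by
      rcases he with rfl | rfl
      exacts [hse.1, hse.2]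
    have h1 := hu _ _ _ ⟨j, s, hs, e, he, hse', rfl, rfl, rfl⟩
    have h2 := hvert i
    rw [hi] at h2
    linarith

end Uniqueness

end Network

/-! ### Discrete costs against exact costs. -/

namespace Network

variable {n : ℕ} {I J : Type*} {G : Network n I J} {f g : EuclideanSpace ℝ (Fin n) → ℝ}
  {B : Set I} {h : ℝ}

lemma abs_sub_add_abs_sub_of_mem_uIcc {A : ℝ → ℝ} (hA : Monotone A) {a b r : ℝ}
    (hr : r ∈ uIcc a b) : |A a - A r| + |A r - A b| = |A a - A b| := by
  rcases le_total a b with hab | hab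
  · rw [uIcc_of_le hab] at hr
    rw [abs_of_nonpos (sub_nonpos.2 (hA hr.1)), abs_of_nonpos (sub_nonpos.2 (hA hr.2)),
      abs_of_nonpos (sub_nonpos.2 (hA hab))]
    ring
  · rw [uIcc_of_ge hab] at hr
    rw [abs_of_nonneg (sub_nonneg.2 (hA hr.2)), abs_of_nonneg (sub_nonneg.2 (hA hr.1)),
      abs_of_nonneg (sub_nonneg.2 (hA hab))]
    ring

variable (G f h) in
/-- The cost of a short discrete step is at most `K` times the exact cost. -/
def StepUpperBound (K : ℝ) : Prop :=
  ∀ j, ∀ a ∈ Icc 0 (G.l j), ∀ b ∈ Icc 0 (G.l j), |a - b| ≤ h →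
    f (G.π j a) * |a - b| ≤ K * |G.potential f j a - G.potential f j b|

variable (G f h) in
/-- The cost of a short discrete step is at least `θ` times the exact cost. -/
def StepLowerBound (θ : ℝ) : Prop :=
  ∀ j, ∀ a ∈ Icc 0 (G.l j), ∀ b ∈ Icc 0 (G.l j), |a - b| ≤ h →
    θ * |G.potential f j a - G.potential f j b| ≤ f (G.π j a) * |a - b|

/-- Moving along an edge by discrete steps. -/
lemma exists_discrete_reach_along_edge (hf : ContinuousOn f G.carrier)
    (hf0 : ∀ x ∈ G.carrier, 0 ≤ f x) (hh : 0 < h) {K : ℝ} (hK : G.StepUpperBound f h K) {j : J}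
    {b c : ℝ} (hb : b ∈ Icc 0 (G.l j))
    (hc : Reach (G.boundary B) g (G.DiscreteStep f h) (G.π j b) c) {a : ℝ}
    (ha : a ∈ Icc 0 (G.l j)) :
    ∃ c', Reach (G.boundary B) g (G.DiscreteStep f h) (G.π j a) c' ∧
      c' ≤ K * |G.potential f j a - G.potential f j b| + c := by
  obtain ⟨N, hN⟩ := exists_nat_ge (|a - b| / h)
  rw [div_le_iff₀ hh] at hN
  induction N generalizing a with
  | zero =>
    obtain rfl : a = b := by
      rw [Nat.cast_zero, zero_mul] at hN
      exact sub_eq_zero.1 (abs_nonpos_iff.1 hN)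
    exact ⟨c, hc, by simp⟩
  | succ N ih =>
    have hN1 : (0 : ℝ) < N + 1 := by positivity
    -- One of `N + 1` equal steps: its length is at most `h`, and at most `N * h` remains.
    set t : ℝ := 1 / (N + 1) with ht
    have ht0 : 0 ≤ t := by positivity
    have ht1 : t ≤ 1 := by rw [ht, div_le_one hN1]; linarith [(Nat.cast_nonneg N : (0 : ℝ) ≤ N)]
    set r := a + t * (b - a) with hr
    have hseg : r ∈ uIcc a b := by
      rw [← segment_eq_uIcc]
      exact ⟨1 - t, t, by linarith, ht0, by ring, by simp only [smul_eq_mul]; ring⟩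
    have hrI : r ∈ Icc 0 (G.l j) := (uIcc_subset_Icc ha hb) hseg
    push_cast at hN
    have har : |a - r| ≤ h := by
      rw [show a - r = t * (a - b) by ring, abs_mul, abs_of_nonneg ht0, ht, one_div,
        inv_mul_le_iff₀ hN1]
      exact hN
    have hrb : |r - b| ≤ N * h := by
      rw [show r - b = (1 - t) * (a - b) by ring, abs_mul, abs_of_nonneg (by linarith)]
      calc (1 - t) * |a - b| ≤ (1 - t) * ((N + 1) * h) :=
            mul_le_mul_of_nonneg_left hN (by linarith)
        _ = N * h := by rw [ht]; field_simp; ring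
    obtain ⟨c', hc', hle⟩ := ih hrI hrb
    refine ⟨_, Reach.cons ⟨j, a, ha, r, hrI, rfl, rfl, har, rfl⟩ hc', ?_⟩
    rw [← abs_sub_add_abs_sub_of_mem_uIcc (monotone_potential hf hf0 j) hseg, mul_add]
    linarith [hK j a ha r hrI har]

variable {m : ℝ} (hg : ∀ x ∈ G.boundary B, -m ≤ g x)

include hg

/-- Chains of edges are approximated by discrete trajectories. -/
lemma exists_discrete_reach (hf : ContinuousOn f G.carrier)
    (hf0 : ∀ x ∈ G.carrier, 0 ≤ f x) (hh : 0 < h) {K : ℝ} (hK1 : 1 ≤ K)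
    (hK : G.StepUpperBound f h K) {x : EuclideanSpace ℝ (Fin n)} {c : ℝ}
    (hc : Reach (G.boundary B) g (G.EdgeStep f) x c) :
    ∃ c', Reach (G.boundary B) g (G.DiscreteStep f h) x c' ∧ c' + m ≤ K * (c + m) := by
  induction hc with
  | @nil x hx =>
    -- The shift by `m` makes the terminal cost nonnegative, so the factor `K ≥ 1` can be applied to
    -- it too.
    refine ⟨_, Reach.nil hx, ?_⟩
    have := hg x hx
    exact le_mul_of_one_le_left (by linarith) hK1
  | @cons x x' c c' hs _ ih =>
    obtain ⟨c₂, hr, hle⟩ := ih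
    obtain ⟨j, a, ha, e, he, -, rfl, rfl, rfl⟩ := hs
    obtain ⟨c₁, hr₁, hle₁⟩ :=
      exists_discrete_reach_along_edge hf hf0 hh hK (endpoint_mem_Icc he) hr ha
    exact ⟨c₁, hr₁, by linarith⟩

lemma neg_le_contValue (hB : B.Nonempty) {x : EuclideanSpace ℝ (Fin n)} (hx : x ∈ G.carrier) :
    -m ≤ G.contValue B f g x :=
  le_csInf (exists_reach hB hx) fun _ hc => Reach.lower_bound hg (fun _ _ _ hs => hs.nonneg) hc

lemma discrete_value_add_le (hB : B.Nonempty) (hf : ContinuousOn f G.carrier)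
    (hf0 : ∀ x ∈ G.carrier, 0 ≤ f x) (hh : 0 < h) {K : ℝ} (hK1 : 1 ≤ K)
    (hK : G.StepUpperBound f h K) {x : EuclideanSpace ℝ (Fin n)} (hx : x ∈ G.carrier) :
    Reach.value (G.boundary B) g (G.DiscreteStep f h) x + m ≤
      K * (G.contValue B f g x + m) := by
  have hK0 : 0 < K := by linarith
  rw [← div_le_iff₀' hK0, ← sub_le_iff_le_add]
  refine le_csInf (exists_reach hB hx) fun c hc => ?_
  obtain ⟨c', hc', hle⟩ := exists_discrete_reach hg hf hf0 hh hK1 hK hc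
  rw [sub_le_iff_le_add, div_le_iff₀' hK0]
  linarith [Reach.value_le hg (fun _ _ _ hs => hs.nonneg hf0) hc']

/-- Verification with `θ (u + m) - m`, `u` being the continuous value: the step bound makes it
compatible with discrete steps, and `θ ≤ 1` with `u + m ≥ 0` keeps it below `g` on `∂Γ`. -/
lemma le_discrete_value_add [Finite J] (hB : B.Nonempty) {θ : ℝ} (hθ0 : 0 ≤ θ) (hθ1 : θ ≤ 1)
    (hθ : G.StepLowerBound f h θ) {x : EuclideanSpace ℝ (Fin n)}
    (hne : ∃ c, Reach (G.boundary B) g (G.DiscreteStep f h) x c) :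
    θ * (G.contValue B f g x + m) ≤
      Reach.value (G.boundary B) g (G.DiscreteStep f h) x + m := by
  rw [← sub_le_iff_le_add]
  refine le_csInf hne fun c hc => ?_
  refine Reach.le_of_step (w := fun x => θ * (G.contValue B f g x + m) - m) ?_ ?_ hc
  · intro y hy
    have h1 := contValue_le_boundary (f := f) hg hy
    have h2 := neg_le_contValue (f := f) hg hB (boundary_subset_carrier B hy)
    nlinarith
  · rintro _ _ _ ⟨j, a, ha, b, hb, rfl, rfl, hab, rfl⟩
    have h1 := hθ j a ha b hb hab
    have h2 := mul_le_mul_of_nonneg_left (contValue_le_of_edge (f := f) hB hg ha hb) hθ0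
    linarith

omit hg

/-- Short discrete steps have almost the exact cost. -/
lemma eventually_step_cost [Finite J] (hf : ContinuousOn f G.carrier) {η : ℝ} (hη : 0 < η)
    (hfη : ∀ x ∈ G.carrier, η ≤ f x) {κ : ℝ} (hκ : 0 < κ) :
    ∀ᶠ h in 𝓝[>] (0 : ℝ), G.StepUpperBound f h (1 + κ) ∧ G.StepLowerBound f h (1 - κ) := by
  have key : ∀ᶠ h in 𝓝[>] (0 : ℝ), ∀ j, ∀ a ∈ Icc 0 (G.l j), ∀ b ∈ Icc 0 (G.l j), |a - b| ≤ h →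
      |f (G.π j a) * |a - b| - (|G.potential f j a - G.potential f j b|)| ≤
        κ * |G.potential f j a - G.potential f j b| := by
    rw [eventually_all]
    intro j
    have huc := isCompact_Icc.uniformContinuousOn_of_continuous
      (continuous_weight hf j).continuousOn (s := Icc 0 (G.l j))
    -- The exact cost is `F r * |a - b|` for some `r` between `a` and `b`; since `η * κ ≤ κ * F r`,
    -- this oscillation is a relative error `κ`.
    obtain ⟨δ, hδ, hδκ⟩ := Metric.uniformContinuousOn_iff.1 huc (η * κ) (by positivity)
    filter_upwards [Ioo_mem_nhdsGT hδ] with h hhI a ha b hb hab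
    have hw := le_weight hfη j
    obtain ⟨r, hr, heq⟩ := exists_abs_sub_eq_mul (hasDerivAt_potential hf j)
      (fun s => hη.trans_le (hw s)) a b
    have hra : |a - r| ≤ |a - b| := by
      rw [abs_sub_comm a r, abs_sub_comm a b]
      exact abs_sub_left_of_mem_uIcc hr
    have hd := hδκ a ha r (uIcc_subset_Icc ha hb hr) ((hra.trans hab).trans_lt hhI.2)
    rw [heq, ← weight_eq (f := f) ha, ← sub_mul, abs_mul, abs_abs, ← mul_assoc]
    refine mul_le_mul_of_nonneg_right ?_ (abs_nonneg _)
    rw [Real.dist_eq] at hd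
    nlinarith [hw r]
  filter_upwards [key] with h hkey
  constructor <;> intro j a ha b hb hab <;> have := abs_le.1 (hkey j a ha b hb hab) <;>
    linarith [this.1, this.2]

/-- A crude constant valid for every `h`, used for finiteness and boundedness of `u_h` when `h` is
not small. -/
lemma exists_stepUpperBound [Finite J] (hf : ContinuousOn f G.carrier) {η : ℝ} (hη : 0 < η)
    (hfη : ∀ x ∈ G.carrier, η ≤ f x) (h : ℝ) : ∃ K, 1 ≤ K ∧ G.StepUpperBound f h K := by
  obtain ⟨M, hM⟩ := G.isCompact_carrier.exists_bound_of_continuousOn hf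
  refine ⟨max 1 (M / η), le_max_left _ _, fun j a ha b hb _ => ?_⟩
  have hw := le_weight hfη j
  obtain ⟨r, hr, heq⟩ := exists_abs_sub_eq_mul (hasDerivAt_potential hf j)
    (fun s => hη.trans_le (hw s)) a b
  rw [heq, ← mul_assoc]
  refine mul_le_mul_of_nonneg_right ?_ (abs_nonneg _)
  calc f (G.π j a) ≤ M := (le_abs_self _).trans (hM _ (π_mem_carrier ha))
    _ = M / η * η := by field_simp
    _ ≤ max 1 (M / η) * G.weight f j r :=
        mul_le_mul (le_max_right _ _) (hw r) hη.le (by positivity)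

end Network

end

/-! ### Assembly. -/

theorem mainTheorem1 {n : ℕ} {I J : Type*} [Finite I] [Finite J] (G : Network n I J)
    (B : Set I) (hB : B.Nonempty) (hB_inc : ∀ i, (G.Inc i).encard = 1 → i ∈ B)
    (f g : EuclideanSpace ℝ (Fin n) → ℝ) (hf : ContinuousOn f G.carrier)
    (η : ℝ) (hη : 0 < η) (hf_pos : ∀ x ∈ G.interior B, η ≤ f x)
    (hcomph : ∀ h > 0, ∀ x ∈ G.boundary B, g x ≤ G.discreteValue B f g h x)
    (hcomp : ∀ x ∈ G.boundary B, ∀ y ∈ G.boundary B, g x - g y ≤ G.optDist f y x) :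
    (∀ h > 0, G.IsSchemeSolution B f g h (G.discreteValue B f g h) ∧
      ∀ w, G.IsSchemeSolution B f g h w → ∀ x ∈ G.carrier, w x ≤ G.discreteValue B f g h x) ∧
    ∃ u : EuclideanSpace ℝ (Fin n) → ℝ,
      G.IsDirichletSolution B f g u ∧
      (∀ w, G.IsDirichletSolution B f g w → EqOn w u G.carrier) ∧
      TendstoUniformlyOn (fun h => G.discreteValue B f g h) u (𝓝[>] 0) G.carrier := by
  have hfη := Network.le_on_carrier hf hf_pos
  have hf0 : ∀ x ∈ G.carrier, 0 ≤ f x := fun x hx => hη.le.trans (hfη x hx)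
  have : Nonempty J := by
    obtain ⟨i, -⟩ := hB
    obtain ⟨j, -⟩ := mem_iUnion.1 (Network.vertex_mem_carrier (G := G) i)
    exact ⟨j⟩
  obtain ⟨m, hg⟩ : ∃ m, ∀ x ∈ G.boundary B, -m ≤ g x := by
    obtain ⟨b, hb⟩ := (((toFinite B).image G.v).image g).bddBelow
    exact ⟨-b, fun x hx => by simpa using hb (mem_image_of_mem g hx)⟩
  set u := G.contValue B f g with hu
  have hlip : G.EdgeLipschitz f u := fun j a ha b hb => Network.abs_contValue_sub_le hB hg ha hb
  have huc : ContinuousOn u G.carrier := Network.continuousOn_of_abs_sub_le hf hlip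
  obtain ⟨C, hC⟩ := G.isCompact_carrier.exists_bound_of_continuousOn huc
  have hneg : ∀ x ∈ G.carrier, -m ≤ u x := fun x hx => Network.neg_le_contValue hg hB hx
  have hne : ∀ h > 0, ∀ x ∈ G.carrier,
      ∃ c, Reach (G.boundary B) g (G.DiscreteStep f h) x c := by
    intro h hh x hx
    obtain ⟨K, hK1, hK⟩ := Network.exists_stepUpperBound hf hη hfη h
    obtain ⟨c, hc⟩ := Network.exists_reach (f := f) (g := g) hB hx
    obtain ⟨c', hc', -⟩ := Network.exists_discrete_reach hg hf hf0 hh hK1 hK hc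
    exact ⟨c', hc'⟩
  have hunif : TendstoUniformlyOn (fun h => G.discreteValue B f g h) u (𝓝[>] 0) G.carrier := by
    rw [Metric.tendstoUniformlyOn_iff]
    intro ε hε
    -- `D` bounds `u + m`, so the error is at most `κ * D ≤ ε / 2`; the cap `κ ≤ 1` keeps the lower
    -- factor `1 - κ` nonnegative.
    set D := |C| + |m| + 1 with hD
    have hDpos : 0 < D := by positivity
    set κ := min 1 (ε / (2 * D)) with hκ
    have hκpos : 0 < κ := lt_min one_pos (by positivity)
    have hκD : κ * D < ε := by
      calc κ * D ≤ ε / (2 * D) * D := mul_le_mul_of_nonneg_right (min_le_right _ _) hDpos.le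
        _ = ε / 2 := by field_simp
        _ < ε := by linarith
    filter_upwards [Network.eventually_step_cost hf hη hfη hκpos, self_mem_nhdsWithin]
      with h ⟨hup, hlow⟩ hh x hx
    rw [Network.discreteValue_eq hh]
    have h1 := Network.discrete_value_add_le hg hB hf hf0 hh (by linarith) hup hx
    have h2 := Network.le_discrete_value_add hg hB (by linarith [min_le_left 1 (ε / (2 * D))])
      (by linarith) hlow (hne h hh x hx)
    rw [← hu] at h1 h2
    have hxD : u x + m ≤ D := by
      have := (le_abs_self _).trans (hC x hx)
      linarith [le_abs_self C, le_abs_self m]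
    have h3 := mul_le_mul_of_nonneg_left hxD hκpos.le
    rw [Real.dist_eq]
    exact (abs_le.2 ⟨by linarith, by linarith⟩ : _ ≤ κ * D).trans_lt hκD
  have hubd : ∀ x ∈ G.boundary B, u x = g x := by
    intro x hx
    refine le_antisymm (Network.contValue_le_boundary hg hx) ?_
    refine ge_of_tendsto (hunif.tendsto_at (Network.boundary_subset_carrier B hx)) ?_
    filter_upwards [self_mem_nhdsWithin] with h hh using hcomph h hh x hx
  refine ⟨fun h hh => ?_, u, ?_, ?_, hunif⟩
  · have hcomph' := hcomph h hh
    rw [Network.discreteValue_eq hh] at hcomph' ⊢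
    refine ⟨Network.isSchemeSolution_value hh hf0 hg (hne h hh) ?_ hcomph',
      fun w hw => hw.le_value hh hf0 (hne h hh) hg hcomph'⟩
    obtain ⟨K, hK1, hK⟩ := Network.exists_stepUpperBound hf hη hfη h
    refine ⟨|m| + K * (C + |m|), fun x hx => ?_⟩
    have h1 := Network.discrete_value_add_le hg hB hf hf0 hh hK1 hK hx
    rw [← hu] at h1
    have h2 : -m ≤ Reach.value (G.boundary B) g (G.DiscreteStep f h) x :=
      le_csInf (hne h hh x hx) fun _ hc =>
        Reach.lower_bound hg (fun _ _ _ hs => hs.nonneg hf0) hc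
    have h3 : u x + m ≤ C + |m| := by
      linarith [(le_abs_self _).trans (hC x hx), le_abs_self m]
    have h4 := mul_le_mul_of_nonneg_left h3 (by linarith : 0 ≤ K)
    have h5 : 0 ≤ K * (C + |m|) := by
      have := hneg x hx
      exact mul_nonneg (by linarith) (by linarith)
    exact abs_le.2 ⟨by linarith [le_abs_self m], by linarith [neg_le_abs m]⟩
  · refine ⟨huc, hlip.isSubsolution hf hf0, hlip.isSupersolution hf hf0 hB_inc
      fun x hx => Network.exists_contValue_eq hB hg hx, hubd⟩
  · intro w ⟨hwc, hsub, hsup, hwg⟩ x hx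
    apply le_antisymm
    · have hwlip := hsub.edgeLipschitz hf hwc
      refine le_csInf (Network.exists_reach hB hx) fun c hc => ?_
      refine Reach.le_of_step (fun y hy => (hwg y hy).le) ?_ hc
      rintro _ _ _ ⟨j, a, ha, e, he, -, rfl, rfl, rfl⟩
      linarith [le_of_abs_le (hwlip j a ha e (Network.endpoint_mem_Icc he))]
    · exact hsup.ge_of_edgeStep hf hη hfη hwc
        (fun _ _ _ hs => Network.contValue_le_add hB hg hs)
        (fun y hy => ((hubd y hy).trans (hwg y hy).symm).le) x hx
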